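/- Let $d\in\mathbb{N}$, let $u_0\in H^1(\mathbb{R}^d)$ be real-valued and let $\xi\in C_c^\infty(\mathbb{R}^d;\mathbb{R}^d)$. Let $\{\boldsymbol{t}_t\}_{t\in\mathbb{R}}$ be the flow of $\xi$, i.e. $\partial_t\boldsymbol{t}_t=\xi\circ\boldsymbol{t}_t$ for all $t\in\mathbb{R}$ and $\boldsymbol{t}_0=\mathrm{id}$. For $t\in\mathbb{R}$ let $u_t=(\boldsymbol{t}_t)_\sharp u_0$ be the push-forward of $u_0$ (as a density with respect to Lebesgue measure) under $\boldsymbol{t}_t$, i.e. $u_t$ is the locally integrable function, unique up to null sets, with \[ \int_{\mathbb{R}^d}u_t\,\zeta\,dx=\int_{\mathbb{R}^d}u_0(x)\,\zeta(\boldsymbol{t}_t(x))\,dx\qquad\text{for all }\zeta\in C_c^0(\mathbb{R}^d). \] Then $u_t\in H^1(\mathbb{R}^d)$ for every $t\in\mathbb{R}$, the function $t\mapsto\int_{\mathbb{R}^d}\frac12|\nabla u_t|^2\,dx$ is differentiable at $t=0$, and \[ \frac{d}{dt}\bigg|_{t=0}\int_{\mathbb{R}^d}\frac12|\nabla u_t|^2\,dx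 =\int_{\mathbb{R}^d}\Big[-\nabla u_0\cdot\nabla\xi\,\nabla u_0-\frac12|\nabla u_0|^2\,\nabla\cdot\xi-u_0\nabla u_0\cdot\nabla(\nabla\cdot\xi)\Big]\,dx, \] where the integrand on the right is integrable. Here $\nabla u$ denotes the weak gradient of $u\in H^1(\mathbb{R}^d)$ and $\nabla\xi$ the Jacobian matrix of $\xi$. -/

import Mathlib

open MeasureTheory
open scoped ContDiff

noncomputable section

namespace DirichletVariation

/-- `ℝᵈ` with its Euclidean norm. -/
abbrev Space (d : ℕ) : Type := EuclideanSpace ℝ (Fin d)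

/-- The `i`-th standard basis vector of `ℝᵈ`. -/
def stdVec {d : ℕ} (i : Fin d) : Space d := EuclideanSpace.single i (1 : ℝ)

/-- The locally integrable vector field `g` is a weak gradient of the locally integrable
function `u`: `∫ u ∂ᵢφ = - ∫ gᵢ φ` for all `φ ∈ C_c^∞(ℝᵈ)` and all `i`. -/
def IsWeakGradient {d : ℕ} (u : Space d → ℝ) (g : Space d → Space d) : Prop :=
  LocallyIntegrable u ∧ LocallyIntegrable g ∧
    ∀ φ : Space d → ℝ, ContDiff ℝ ∞ φ → HasCompactSupport φ → ∀ i : Fin d,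
      ∫ x, u x * fderiv ℝ φ x (stdVec i) = - ∫ x, g x i * φ x

/-- `u ∈ H¹(ℝᵈ)`: `u ∈ L²` and `u` has a weak gradient in `L²`. -/
def MemH1 {d : ℕ} (u : Space d → ℝ) : Prop :=
  MemLp u 2 ∧ ∃ g : Space d → Space d, MemLp g 2 ∧ IsWeakGradient u g

open Classical in
/-- The weak gradient `∇u` (unique up to null sets); `0` if `u` has none. -/
def weakGrad {d : ℕ} (u : Space d → ℝ) : Space d → Space d :=
  if h : ∃ g : Space d → Space d, IsWeakGradient u g then h.choose else 0

/-- The Dirichlet energy `∫ ½ |∇u|² dx`. -/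
def dirichletEnergy {d : ℕ} (u : Space d → ℝ) : ℝ :=
  ∫ x, (1 / 2 : ℝ) * ‖weakGrad u x‖ ^ 2

/-- The divergence `∇ · ξ = ∑ᵢ ∂ᵢ ξᵢ`. -/
def divergence {d : ℕ} (ξ : Space d → Space d) (x : Space d) : ℝ :=
  ∑ i : Fin d, fderiv ℝ ξ x (stdVec i) i

/-- `T` is the flow of `ξ`: `∂ₜ Tₜ = ξ ∘ Tₜ` for all `t ∈ ℝ`, and `T₀ = id`. -/
def IsFlow {d : ℕ} (ξ : Space d → Space d) (T : ℝ → Space d → Space d) : Prop :=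
  (∀ x, T 0 x = x) ∧ ∀ t x, HasDerivAt (fun s => T s x) (ξ (T t x)) t

/-- The locally integrable function `v` is the push-forward `S_♯ u` (of `u` as a density with
respect to Lebesgue measure): `∫ v ζ = ∫ u (ζ ∘ S)` for all `ζ ∈ C_c⁰(ℝᵈ)`. -/
def IsPushforward {d : ℕ} (S : Space d → Space d) (u v : Space d → ℝ) : Prop :=
  LocallyIntegrable v ∧
    ∀ ζ : Space d → ℝ, Continuous ζ → HasCompactSupport ζ →
      ∫ x, v x * ζ x = ∫ x, u x * ζ (S x)

/-- The integrand
`-∇u · ∇ξ ∇u - ½ |∇u|² ∇·ξ - u ∇u · ∇(∇·ξ)`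
of the first variation of the Dirichlet energy. -/
def variationIntegrand {d : ℕ} (u : Space d → ℝ) (ξ : Space d → Space d) (x : Space d) : ℝ :=
  - inner ℝ (weakGrad u x) (fderiv ℝ ξ x (weakGrad u x))
    - (1 / 2 : ℝ) * ‖weakGrad u x‖ ^ 2 * divergence ξ x
    - u x * inner ℝ (weakGrad u x) (gradient (divergence ξ) x)

end DirichletVariation

end

/-! Write ℓ_t = ∫₀ᵗ (∇·ξ) ∘ T_s ds, so that det DT_t = exp ℓ_t by Liouville (`IsFlow.det_fderiv`).
The push-forward satisfies u_t ∘ T_t = exp(-ℓ_t) u₀. The chain rule then suggests that (∂ᵢu_t) ∘ T_t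
= exp(-ℓ_t) pᵢ, where pᵢ = ∇u₀ · (DT_t)⁻¹eᵢ - u₀ Dℓ_t((DT_t)⁻¹eᵢ) is `pullGradCoord`. The change of
variables x = T_t y turns the energy into ∫ ½ exp(-ℓ_t) ∑ᵢ pᵢ² dy
(`IsPushforward.dirichletEnergy_eq`). Here u₀ and ∇u₀ are evaluated at the fixed point y, and time
enters only through coefficients determined by the flow.

At t = 0 the derivatives of exp(-ℓ_t), (DT_t)⁻¹ and Dℓ_t are -∇·ξ, -∇ξ and D(∇·ξ), and the product
rule produces the stated integrand. For |t| ≤ 1 the difference from the value at t = 0 is at most C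
|t| (|∇u₀| + |u₀|)², with C independent of y. This is integrable because u₀ ∈ H¹, so dominated
convergence applies.

The delicate point is the weak chain rule, because the flow is only shown to be C¹ in space.
Transporting a test function φ yields the field φ(T_t y) (DT_t)⁻¹eᵢ, which is merely known to be
continuous and so cannot be tested directly against ∇u₀. Integration by parts for the C¹
push-forward of a smooth w shows, however, that this field has a continuous weak divergence
(`IsFlow.integral_test_eq_zero`). Mollification commutes with the divergence, so the weak gradient
of u₀ may be tested against such fields in the limit
(`IsWeakGradient.integral_mul_add_inner_eq_zero`). This gives
`IsWeakGradient.integral_mul_fderiv_comp_flow`. -/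

namespace DirichletVariation

/-! ### Grönwall estimates. -/

section Gronwall

variable {F : Type*} [NormedAddCommGroup F] [NormedSpace ℝ F]

/-- Linearity in the forcing term lets powers of the distance between initial points be pulled out
of Grönwall bounds. -/
theorem gronwallBound_zero_eq_mul (K ε x : ℝ) :
    gronwallBound 0 K ε x = ε * gronwallBound 0 K 1 x := by
  by_cases hK : K = 0
  · simp [gronwallBound, hK]
  · simp only [gronwallBound, if_neg hK]
    ring

/-- Grönwall's inequality on both sides of the initial time. -/
theorem norm_le_gronwallBound_abs {f f' : ℝ → F} {a K ε δ : ℝ}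
    (hf : ∀ t, |t| < δ → HasDerivAt f (f' t) t) (h0 : ‖f 0‖ ≤ a)
    (hb : ∀ t, |t| < δ → ‖f' t‖ ≤ K * ‖f t‖ + ε) {t : ℝ} (ht : |t| < δ) :
    ‖f t‖ ≤ gronwallBound a K ε |t| := by
  have key : ∀ (g g' : ℝ → F), (∀ t, |t| < δ → HasDerivAt g (g' t) t) → ‖g 0‖ ≤ a →
      (∀ t, |t| < δ → ‖g' t‖ ≤ K * ‖g t‖ + ε) → ∀ s, 0 ≤ s → s < δ →
      ‖g s‖ ≤ gronwallBound a K ε s := by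
    intro g g' hg hg0 hgb s hs hsδ
    have habs : ∀ x ∈ Set.Icc 0 s, |x| < δ := fun x hx => by
      rw [abs_of_nonneg hx.1]; exact hx.2.trans_lt hsδ
    have := norm_le_gronwallBound_of_norm_deriv_right_le (f := g) (f' := g') (a := 0) (b := s)
      (δ := a) (K := K) (ε := ε)
      (fun x hx => (hg x (habs x hx)).continuousAt.continuousWithinAt)
      (fun x hx => (hg x (habs x ⟨hx.1, hx.2.le⟩)).hasDerivWithinAt) hg0
      (fun x hx => hgb x (habs x ⟨hx.1, hx.2.le⟩)) s ⟨hs, le_rfl⟩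
    simpa using this
  rcases le_total 0 t with h | h
  · rw [abs_of_nonneg h] at ht ⊢
    exact key f f' hf h0 hb t h ht
  · rw [abs_of_nonpos h] at ht ⊢
    have := key (fun s => f (-s)) (fun s => - f' (-s))
      (fun s hs => by
        have := (hf (-s) (by simpa using hs)).scomp s (hasDerivAt_neg s)
        simpa [Function.comp_def] using this)
      (by simpa using h0) (fun s hs => by simpa using hb (-s) (by simpa using hs)) (-t)
      (by linarith) ht
    simpa using this

end Gronwall

/-! ### The flow: group law, Lipschitz bounds, and C¹ dependence on the initial point. -/

variable {d : ℕ} {ξ : Space d → Space d} {T : ℝ → Space d → Space d}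

/-- The equation is autonomous, so both sides solve it in `s` from the same point T_t x, and
uniqueness applies. -/
theorem IsFlow.add_of_lipschitz {K : NNReal} (hT : IsFlow ξ T) (hK : LipschitzWith K ξ) (s t : ℝ)
    (x : Space d) : T (s + t) x = T s (T t x) := by
  have h := ODE_solution_unique_univ (v := fun _ => ξ) (s := fun _ => Set.univ) (K := K)
    (f := fun r => T (r + t) x) (g := fun r => T r (T t x)) (t₀ := 0)
    (fun _ => hK.lipschitzOnWith)
    (fun r => ⟨by simpa using (hT.2 (r + t) x).comp_add_const r t, trivial⟩)
    (fun r => ⟨hT.2 r (T t x), trivial⟩) (by simp [hT.1])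
  exact congrFun h s

theorem IsFlow.norm_sub_le {K : NNReal} (hT : IsFlow ξ T) (hK : LipschitzWith K ξ) (t : ℝ)
    (x y : Space d) : ‖T t x - T t y‖ ≤ Real.exp (K * |t|) * ‖x - y‖ := by
  have h := norm_le_gronwallBound_abs (f := fun s => T s x - T s y)
    (f' := fun s => ξ (T s x) - ξ (T s y)) (a := ‖x - y‖) (K := K) (ε := 0) (δ := |t| + 1)
    (fun s _ => (hT.2 s x).sub (hT.2 s y)) (by simp [hT.1])
    (fun s _ => by simpa using hK.norm_sub_le (T s x) (T s y)) (t := t) (by linarith)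
  rw [gronwallBound_ε0] at h
  linarith

theorem IsFlow.lipschitzWith {K : NNReal} (hT : IsFlow ξ T) (hK : LipschitzWith K ξ) (t : ℝ) :
    LipschitzWith (Real.exp (K * |t|)).toNNReal (T t) :=
  LipschitzWith.of_dist_le_mul fun x y => by
    rw [Real.coe_toNNReal _ (Real.exp_pos _).le, dist_eq_norm, dist_eq_norm]
    exact hT.norm_sub_le hK t x y

theorem IsFlow.continuous_time (hT : IsFlow ξ T) (x : Space d) : Continuous fun t => T t x :=
  continuous_iff_continuousAt.2 fun t => (hT.2 t x).continuousAt

/-- The linearised equation along a trajectory is solvable for short times. -/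
theorem IsFlow.exists_linearization {K : NNReal} (hT : IsFlow ξ T) (hξ : ContDiff ℝ 1 ξ)
    (hK : LipschitzWith K ξ) {δ : ℝ} (hδ : 0 < δ) (hKδ : K * 2 * δ ≤ 1) (x : Space d) :
    ∃ A : ℝ → (Space d →L[ℝ] Space d), A 0 = ContinuousLinearMap.id ℝ _ ∧
      ∀ t, |t| < δ → HasDerivAt A (fderiv ℝ ξ (T t x) ∘L A t) t := by
  have hb : ∀ y, ‖fderiv ℝ ξ y‖ ≤ K := fun y => norm_fderiv_le_of_lipschitz ℝ hK
  have h0 : (0 : ℝ) ∈ Set.Icc (-δ) δ := ⟨by linarith, hδ.le⟩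
  -- The unit ball around the identity lies in ‖Y‖ ≤ 2, where the right-hand side is at most 2K. The
  -- condition 2Kδ ≤ 1 keeps solutions inside the ball, and δ does not depend on x.
  have hPL : IsPicardLindelof (fun t (Y : Space d →L[ℝ] Space d) => fderiv ℝ ξ (T t x) ∘L Y)
      (tmin := -δ) (tmax := δ) ⟨0, h0⟩ (ContinuousLinearMap.id ℝ _) 1 0 (K * 2) K := by
    refine ⟨fun t _ => LipschitzWith.lipschitzOnWith ?_, fun Y _ => ?_, fun t _ Y hY => ?_, ?_⟩
    · refine LipschitzWith.of_dist_le_mul fun Y Z => ?_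
      rw [dist_eq_norm, dist_eq_norm, ← ContinuousLinearMap.comp_sub]
      exact (ContinuousLinearMap.opNorm_comp_le _ _).trans (by gcongr; exact hb _)
    · have : Continuous fun t => fderiv ℝ ξ (T t x) :=
        (hξ.continuous_fderiv one_ne_zero).comp (hT.continuous_time x)
      exact (this.clm_comp continuous_const).continuousOn
    · have hY2 : ‖Y‖ ≤ 2 := by
        rw [mem_closedBall_iff_norm] at hY
        have h1 := norm_le_norm_add_norm_sub' Y (ContinuousLinearMap.id ℝ (Space d))
        have h2 : ‖ContinuousLinearMap.id ℝ (Space d)‖ ≤ 1 := ContinuousLinearMap.norm_id_le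
        have h3 : ((1 : NNReal) : ℝ) = 1 := rfl
        linarith
      refine (ContinuousLinearMap.opNorm_comp_le _ _).trans ?_
      push_cast
      exact mul_le_mul (hb _) hY2 (norm_nonneg _) K.2
    · simpa using hKδ
  obtain ⟨A, hA0, hA⟩ := hPL.exists_eq_forall_mem_Icc_hasDerivWithinAt₀
  refine ⟨A, hA0, fun t ht => ?_⟩
  obtain ⟨h1, h2⟩ := abs_lt.1 ht
  exact (hA t ⟨h1.le, h2.le⟩).hasDerivAt (Icc_mem_nhds h1 h2)

/-- Taylor's formula of first order with quadratic remainder. -/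
theorem norm_sub_sub_fderiv_le {E F : Type*} [NormedAddCommGroup E] [NormedSpace ℝ E]
    [NormedAddCommGroup F] [NormedSpace ℝ F] {f : E → F} {M : NNReal}
    (hf : Differentiable ℝ f) (hM : LipschitzWith M (fderiv ℝ f)) (x y : E) :
    ‖f y - f x - fderiv ℝ f x (y - x)‖ ≤ M * ‖y - x‖ ^ 2 := by
  have h := Convex.norm_image_sub_le_of_norm_hasFDerivWithin_le' (f := f) (f' := fderiv ℝ f)
    (φ := fderiv ℝ f x) (s := segment ℝ x y) (C := M * ‖y - x‖) (x := x) (y := y)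
    (fun z _ => (hf z).hasFDerivAt.hasFDerivWithinAt)
    (fun z hz => by
      refine (hM.norm_sub_le z x).trans ?_
      gcongr
      obtain ⟨θ, hθ, rfl⟩ := segment_eq_image' ℝ x y ▸ hz
      rw [add_sub_cancel_left, norm_smul, Real.norm_of_nonneg hθ.1]
      exact mul_le_of_le_one_left (norm_nonneg _) hθ.2)
    (convex_segment x y) (left_mem_segment ℝ x y) (right_mem_segment ℝ x y)
  rw [pow_two, ← mul_assoc]
  exact h

/-- For short times the flow is continuously differentiable and its derivative solves the
linearised equation. -/
theorem IsFlow.exists_contDiff_of_small {K M : NNReal} (hT : IsFlow ξ T) (hξ : ContDiff ℝ 1 ξ)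
    (hK : LipschitzWith K ξ) (hM : LipschitzWith M (fderiv ℝ ξ)) :
    ∃ δ > 0, (∀ t, |t| < δ → ContDiff ℝ 1 (T t)) ∧
      ∀ x, HasDerivAt (fun t => fderiv ℝ (T t) x) (fderiv ℝ ξ x) 0 := by
  obtain ⟨δ, hδ, hKδ⟩ : ∃ δ : ℝ, 0 < δ ∧ K * 2 * δ ≤ 1 := by
    refine ⟨1 / (K * 2 + 1), by positivity, ?_⟩
    rw [mul_one_div, div_le_one (by positivity)]
    linarith
  choose A hA0 hA using fun x => hT.exists_linearization hξ hK hδ hKδ x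
  have hb : ∀ y, ‖fderiv ℝ ξ y‖ ≤ K := fun y => norm_fderiv_le_of_lipschitz ℝ hK
  have hAb : ∀ x t, |t| < δ → ‖A x t‖ ≤ Real.exp (K * δ) := by
    intro x t ht
    have h := norm_le_gronwallBound_abs (hA x) (a := 1) (K := K) (ε := 0)
      (by rw [hA0]; exact ContinuousLinearMap.norm_id_le)
      (fun s _ => by
        rw [add_zero]
        exact (ContinuousLinearMap.opNorm_comp_le _ _).trans (by gcongr; exact hb _)) ht
    rw [gronwallBound_ε0, one_mul] at h
    exact h.trans (Real.exp_le_exp.2 (by gcongr))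
  have hexp : ∀ t, |t| < δ → Real.exp (K * |t|) ≤ Real.exp (K * δ) := fun t ht =>
    Real.exp_le_exp.2 (by gcongr)
  -- The linearisation error starts at 0 and solves the linearised equation along the trajectory of
  -- x, forced by the Taylor remainder of ξ. That remainder is quadratic in ‖y - x‖ by the Lipschitz
  -- bounds on Dξ and on the flow.
  have hrem : ∀ x y t, |t| < δ → ‖T t y - T t x - A x t (y - x)‖ ≤
      (M * Real.exp (K * δ) ^ 2 * gronwallBound 0 K 1 δ) * ‖y - x‖ ^ 2 := by
    intro x y t ht
    have h := norm_le_gronwallBound_abs (f := fun s => T s y - T s x - A x s (y - x))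
      (f' := fun s => ξ (T s y) - ξ (T s x) - (fderiv ℝ ξ (T s x) ∘L A x s) (y - x))
      (δ := δ) (a := 0) (K := K) (ε := M * (Real.exp (K * δ) * ‖y - x‖) ^ 2)
      (fun s hs => ((hT.2 s y).sub (hT.2 s x)).sub 
        (by simpa using (hA x s hs).clm_apply (hasDerivAt_const s (y - x))))
      (by simp [hT.1, hA0])
      (fun s hs => by
        have e : ξ (T s y) - ξ (T s x) - (fderiv ℝ ξ (T s x) ∘L A x s) (y - x) =
            fderiv ℝ ξ (T s x) (T s y - T s x - A x s (y - x)) +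
            (ξ (T s y) - ξ (T s x) - fderiv ℝ ξ (T s x) (T s y - T s x)) := by
          simp only [map_sub, ContinuousLinearMap.comp_apply]
          abel
        rw [e]
        refine (norm_add_le _ _).trans (add_le_add ?_ ?_)
        · exact (ContinuousLinearMap.le_opNorm _ _).trans (by gcongr; exact hb _)
        · refine (norm_sub_sub_fderiv_le (hξ.differentiable one_ne_zero) hM _ _).trans ?_
          gcongr
          exact (hT.norm_sub_le hK s y x).trans (by gcongr)) ht
    rw [gronwallBound_zero_eq_mul] at h
    have hmono := gronwallBound_mono (δ := 0) (K := K) (ε := 1) le_rfl zero_le_one K.2 ht.le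
    calc _ ≤ M * (Real.exp (K * δ) * ‖y - x‖) ^ 2 * gronwallBound 0 K 1 |t| := h
      _ ≤ M * (Real.exp (K * δ) * ‖y - x‖) ^ 2 * gronwallBound 0 K 1 δ := by gcongr
      _ = _ := by ring
  have hfd : ∀ x t, |t| < δ → HasFDerivAt (T t) (A x t) x := by
    intro x t ht
    rw [hasFDerivAt_iff_isLittleO_nhds_zero]
    refine Asymptotics.IsBigO.trans_isLittleO (g := fun h : Space d => ‖h‖ ^ 2) ?_
      (Asymptotics.isLittleO_norm_pow_id one_lt_two)
    refine Asymptotics.IsBigO.of_bound (M * Real.exp (K * δ) ^ 2 * gronwallBound 0 K 1 δ)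
      (Filter.Eventually.of_forall fun h => ?_)
    simpa using hrem x (x + h) t ht
  -- The same argument for two linearised solutions: the difference of their coefficients is the
  -- forcing, now linear in ‖x - y‖. This provides continuity of the derivative in space.
  have hAlip : ∀ x y t, |t| < δ → ‖A x t - A y t‖ ≤
      (M * Real.exp (K * δ) ^ 2 * gronwallBound 0 K 1 δ) * ‖x - y‖ := by
    intro x y t ht
    have h := norm_le_gronwallBound_abs (f := fun s => A x s - A y s)
      (f' := fun s => fderiv ℝ ξ (T s x) ∘L A x s - fderiv ℝ ξ (T s y) ∘L A y s)
      (δ := δ) (a := 0) (K := K) (ε := M * (Real.exp (K * δ) * ‖x - y‖) * Real.exp (K * δ))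
      (fun s hs => (hA x s hs).sub (hA y s hs)) (by simp [hA0])
      (fun s hs => by
        have e : fderiv ℝ ξ (T s x) ∘L A x s - fderiv ℝ ξ (T s y) ∘L A y s =
            fderiv ℝ ξ (T s x) ∘L (A x s - A y s) +
            (fderiv ℝ ξ (T s x) - fderiv ℝ ξ (T s y)) ∘L A y s := by
          rw [ContinuousLinearMap.comp_sub, ContinuousLinearMap.sub_comp]; abel
        rw [e]
        refine (norm_add_le _ _).trans (add_le_add ?_ ?_)
        · exact (ContinuousLinearMap.opNorm_comp_le _ _).trans (by gcongr; exact hb _)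
        · refine (ContinuousLinearMap.opNorm_comp_le _ _).trans ?_
          refine mul_le_mul ?_ (hAb y s hs) (norm_nonneg _) (by positivity)
          refine (hM.norm_sub_le _ _).trans ?_
          gcongr
          exact (hT.norm_sub_le hK s x y).trans (by gcongr)) ht
    rw [gronwallBound_zero_eq_mul] at h
    have hmono := gronwallBound_mono (δ := 0) (K := K) (ε := 1) le_rfl zero_le_one K.2 ht.le
    calc _ ≤ M * (Real.exp (K * δ) * ‖x - y‖) * Real.exp (K * δ) * gronwallBound 0 K 1 |t| := h
      _ ≤ M * (Real.exp (K * δ) * ‖x - y‖) * Real.exp (K * δ) * gronwallBound 0 K 1 δ := by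
        gcongr
      _ = _ := by ring
  refine ⟨δ, hδ, fun t ht => ?_, fun x => ?_⟩
  · refine contDiff_one_iff_fderiv.2 ⟨fun x => (hfd x t ht).differentiableAt, ?_⟩
    have : fderiv ℝ (T t) = fun x => A x t := funext fun x => (hfd x t ht).fderiv
    rw [this]
    exact (LipschitzWith.of_dist_le' (K := M * Real.exp (K * δ) ^ 2 * gronwallBound 0 K 1 δ)
      fun x y => by simpa [dist_eq_norm] using hAlip x y t ht).continuous
  · have h := hA x 0 (by simpa using hδ)
    rw [hA0, hT.1, ContinuousLinearMap.comp_id] at h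
    refine h.congr_of_eventuallyEq ?_
    filter_upwards [Metric.ball_mem_nhds (0 : ℝ) hδ] with t ht
    exact (hfd x t (by simpa using ht)).fderiv

theorem IsFlow.norm_fderiv_le {K : NNReal} (hT : IsFlow ξ T) (hK : LipschitzWith K ξ) (t : ℝ)
    (x : Space d) : ‖fderiv ℝ (T t) x‖ ≤ Real.exp (K * |t|) := by
  simpa [(Real.exp_pos _).le] using norm_fderiv_le_of_lipschitz ℝ (hT.lipschitzWith hK t) (x₀ := x)

theorem exists_lipschitzWith (hξ : ContDiff ℝ ∞ ξ) (hξc : HasCompactSupport ξ) :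
    ∃ K : NNReal, LipschitzWith K ξ :=
  hξ.lipschitzWith_of_hasCompactSupport hξc (by simp)

theorem exists_lipschitzWith_fderiv (hξ : ContDiff ℝ ∞ ξ) (hξc : HasCompactSupport ξ) :
    ∃ M : NNReal, LipschitzWith M (fderiv ℝ ξ) :=
  (hξ.fderiv_right (m := ∞) le_rfl).lipschitzWith_of_hasCompactSupport
    (hξc.fderiv ℝ) (by simp)

theorem IsFlow.add (hT : IsFlow ξ T) (hξ : ContDiff ℝ ∞ ξ) (hξc : HasCompactSupport ξ) (s t : ℝ)
    (x : Space d) : T (s + t) x = T s (T t x) :=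
  let ⟨_, hK⟩ := exists_lipschitzWith hξ hξc
  hT.add_of_lipschitz hK s t x

theorem IsFlow.neg_apply_self (hT : IsFlow ξ T) (hξ : ContDiff ℝ ∞ ξ)
    (hξc : HasCompactSupport ξ) (t : ℝ) (x : Space d) : T (-t) (T t x) = x := by
  rw [← hT.add hξ hξc, neg_add_cancel, hT.1]

theorem IsFlow.apply_neg_self (hT : IsFlow ξ T) (hξ : ContDiff ℝ ∞ ξ)
    (hξc : HasCompactSupport ξ) (t : ℝ) (x : Space d) : T t (T (-t) x) = x := by
  rw [← hT.add hξ hξc, add_neg_cancel, hT.1]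

theorem IsFlow.contDiff (hT : IsFlow ξ T) (hξ : ContDiff ℝ ∞ ξ)
    (hξc : HasCompactSupport ξ) (t : ℝ) :
    ContDiff ℝ 1 (T t) := by
  obtain ⟨K, hK⟩ := exists_lipschitzWith hξ hξc
  obtain ⟨M, hM⟩ := exists_lipschitzWith_fderiv hξ hξc
  obtain ⟨δ, hδ, h, -⟩ := hT.exists_contDiff_of_small (hξ.of_le (by simp)) hK hM
  -- T_t = T_{t/2} ∘ T_{t/2}, so each composition doubles the range of times on which the flow is
  -- known to be C¹.
  have key : ∀ n : ℕ, ∀ t, |t| < 2 ^ n * δ → ContDiff ℝ 1 (T t) := by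
    intro n
    induction n with
    | zero => intro t ht; exact h t (by simpa using ht)
    | succ n ih =>
      intro t ht
      have h2 := ih (t / 2) (by rw [abs_div, abs_two]; rw [pow_succ] at ht; linarith)
      have : T t = T (t / 2) ∘ T (t / 2) := funext fun x => by
        rw [Function.comp_apply, ← hT.add hξ hξc, add_halves]
      rw [this]
      exact h2.comp h2
  obtain ⟨n, hn⟩ := pow_unbounded_of_one_lt (|t| / δ) one_lt_two
  exact key n t (by rwa [div_lt_iff₀ hδ] at hn)

/-- The derivative of the flow solves the linearised equation. -/
theorem IsFlow.hasDerivAt_fderiv (hT : IsFlow ξ T) (hξ : ContDiff ℝ ∞ ξ)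
    (hξc : HasCompactSupport ξ) (t : ℝ) (x : Space d) :
    HasDerivAt (fun t => fderiv ℝ (T t) x) (fderiv ℝ ξ (T t x) ∘L fderiv ℝ (T t) x) t := by
  obtain ⟨K, hK⟩ := exists_lipschitzWith hξ hξc
  obtain ⟨M, hM⟩ := exists_lipschitzWith_fderiv hξ hξc
  obtain ⟨δ, hδ, -, h⟩ := hT.exists_contDiff_of_small (hξ.of_le (by simp)) hK hM
  have hd : ∀ s, Differentiable ℝ (T s) := fun s =>
    (hT.contDiff hξ hξc s).differentiable one_ne_zero
  -- Factoring T_s = T_{s-t} ∘ T_t moves the differentiation to time 0 at the point T_t x, where the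
  -- short-time result applies.
  have e : (fun s => fderiv ℝ (T s) x) =
      fun s => fderiv ℝ (T (s - t)) (T t x) ∘L fderiv ℝ (T t) x := by
    funext s
    rw [← fderiv_comp x (hd _ _) (hd _ _)]
    congr 1
    funext y
    rw [Function.comp_apply, ← hT.add hξ hξc, sub_add_cancel]
  rw [e]
  have h1 : HasDerivAt (fun s => fderiv ℝ (T (s - t)) (T t x)) (fderiv ℝ ξ (T t x)) t :=
    HasDerivAt.comp_sub_const (f := fun s => fderiv ℝ (T s) (T t x)) t t
      (by simpa using h (T t x))
  simpa using h1.clm_comp (hasDerivAt_const t (fderiv ℝ (T t) x))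

theorem IsFlow.fderiv_neg_comp (hT : IsFlow ξ T) (hξ : ContDiff ℝ ∞ ξ)
    (hξc : HasCompactSupport ξ) (t : ℝ) (x : Space d) :
    fderiv ℝ (T (-t)) (T t x) ∘L fderiv ℝ (T t) x = ContinuousLinearMap.id ℝ _ := by
  have hd : ∀ s, Differentiable ℝ (T s) := fun s =>
    (hT.contDiff hξ hξc s).differentiable one_ne_zero
  rw [← fderiv_comp x (hd _ _) (hd _ _)]
  have : T (-t) ∘ T t = id := funext fun y => hT.neg_apply_self hξ hξc t y
  rw [this, fderiv_id]

end DirichletVariation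

/-! ### The Jacobian determinant of the flow, its logarithm, and change of variables. -/

namespace DirichletVariation

/-- The derivative of the determinant at the identity is the trace. -/
theorem hasDerivAt_matrix_det_one {n : Type*} [Fintype n] [DecidableEq n]
    {A : ℝ → Matrix n n ℝ} {A' : Matrix n n ℝ} {t : ℝ} (h1 : A t = 1)
    (hA : ∀ i j, HasDerivAt (fun s => A s i j) (A' i j) t) :
    HasDerivAt (fun s => (A s).det) A'.trace t := by
  let D : ContinuousMultilinearMap ℝ (fun _ : n => n → ℝ) ℝ :=
    { toMultilinearMap := (Matrix.detRowAlternating (R := ℝ) (n := n)).toMultilinearMap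
      cont := Continuous.matrix_det (A := fun M : Matrix n n ℝ => M) continuous_id }
  have hA' : HasDerivAt (fun s => (fun i j => A s i j : n → n → ℝ)) (fun i j => A' i j) t :=
    hasDerivAt_pi.2 fun i => hasDerivAt_pi.2 fun j => hA i j
  have h := (D.hasFDerivAt (fun i j => A t i j)).comp_hasDerivAt t hA'
  have e : D.linearDeriv (fun i j => A t i j) (fun i j => A' i j) = A'.trace := by
    rw [ContinuousMultilinearMap.linearDeriv_apply, Matrix.trace]
    refine Finset.sum_congr rfl fun i _ => ?_
    -- The derivative of a multilinear map replaces one row at a time. Replacing row i of the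
    -- identity gives a determinant equal to the i-th entry of the new row.
    change ((A t).updateRow i (A' i)).det = _
    rw [h1, ← Matrix.cramer_transpose_apply, Matrix.transpose_one, Matrix.cramer_one]
    rfl
  rw [e] at h
  exact h

variable {d : ℕ}

theorem hasDerivAt_det_id {A : ℝ → (Space d →L[ℝ] Space d)} {A' : Space d →L[ℝ] Space d} {t : ℝ}
    (h1 : A t = ContinuousLinearMap.id ℝ _) (hA : HasDerivAt A A' t) :
    HasDerivAt (fun s => (A s).det) (∑ i, A' (stdVec i) i) t := by
  let b := (EuclideanSpace.basisFun (Fin d) ℝ).toBasis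
  have hentry : ∀ (L : Space d →L[ℝ] Space d) i j,
      LinearMap.toMatrix b b (L : Space d →ₗ[ℝ] Space d) i j = L (stdVec j) i := by
    intro L i j
    simp [b, LinearMap.toMatrix_apply, stdVec]
  have h := hasDerivAt_matrix_det_one (A := fun s => LinearMap.toMatrix b b (A s))
    (A' := LinearMap.toMatrix b b A') (t := t)
    (by rw [h1]; exact LinearMap.toMatrix_id b)
    (fun i j => by
      simp only [hentry]
      have h2 := hA.clm_apply (hasDerivAt_const t (stdVec j))
      simp only [map_zero, add_zero] at h2
      exact (EuclideanSpace.proj (𝕜 := ℝ) i).hasFDerivAt.comp_hasDerivAt t h2)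
  simp only [LinearMap.det_toMatrix, Matrix.trace, Matrix.diag, hentry] at h
  exact h

variable {ξ : Space d → Space d} {T : ℝ → Space d → Space d}

theorem contDiff_divergence (hξ : ContDiff ℝ ∞ ξ) : ContDiff ℝ ∞ (divergence ξ) := by
  unfold divergence
  refine ContDiff.sum fun i _ => ?_
  have h : ContDiff ℝ ∞ fun x => fderiv ℝ ξ x (stdVec i) :=
    (hξ.fderiv_right (m := ∞) le_rfl).clm_apply contDiff_const
  exact (EuclideanSpace.proj (𝕜 := ℝ) i).contDiff.comp h

theorem hasCompactSupport_divergence (hξc : HasCompactSupport ξ) :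
    HasCompactSupport (divergence ξ) :=
  (hξc.fderiv ℝ).mono fun x hx => by
    rw [Function.mem_support] at hx ⊢
    contrapose! hx
    simp [divergence, hx]

/-- The logarithm of the Jacobian determinant of the flow. -/
noncomputable def logJacobian (ξ : Space d → Space d) (T : ℝ → Space d → Space d) (t : ℝ)
    (x : Space d) : ℝ :=
  ∫ s in (0 : ℝ)..t, divergence ξ (T s x)

theorem logJacobian_zero (x : Space d) : logJacobian ξ T 0 x = 0 := by
  simp [logJacobian]

theorem IsFlow.continuous_divergence (hT : IsFlow ξ T) (hξ : ContDiff ℝ ∞ ξ) (x : Space d) :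
    Continuous fun s => divergence ξ (T s x) :=
  (contDiff_divergence hξ).continuous.comp (hT.continuous_time x)

theorem IsFlow.hasDerivAt_logJacobian (hT : IsFlow ξ T) (hξ : ContDiff ℝ ∞ ξ) (t : ℝ)
    (x : Space d) : HasDerivAt (fun s => logJacobian ξ T s x) (divergence ξ (T t x)) t :=
  (hT.continuous_divergence hξ x).integral_hasStrictDerivAt 0 t |>.hasDerivAt

/-- Liouville's formula for the Jacobian determinant of a flow. -/
theorem IsFlow.det_fderiv (hT : IsFlow ξ T) (hξ : ContDiff ℝ ∞ ξ) (hξc : HasCompactSupport ξ)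
    (t : ℝ) (x : Space d) :
    (fderiv ℝ (T t) x).det = Real.exp (logJacobian ξ T t x) := by
  have hT0 : T 0 = id := funext hT.1
  have hd : ∀ s, Differentiable ℝ (T s) := fun s =>
    (hT.contDiff hξ hξc s).differentiable one_ne_zero
  have h0 : ∀ y, HasDerivAt (fun s => (fderiv ℝ (T s) y).det) (divergence ξ y) 0 := by
    intro y
    have h := hT.hasDerivAt_fderiv hξ hξc 0 y
    rw [hT0, fderiv_id, ContinuousLinearMap.comp_id] at h
    exact hasDerivAt_det_id (by rw [hT0, fderiv_id]) h
  have h1 : ∀ s, HasDerivAt (fun r => (fderiv ℝ (T r) x).det)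
      (divergence ξ (T s x) * (fderiv ℝ (T s) x).det) s := by
    intro s
    -- The group law and multiplicativity of the determinant reduce the derivative at s to the
    -- derivative at time 0, where DT is the identity.
    have e : (fun r => (fderiv ℝ (T r) x).det) =
        fun r => (fderiv ℝ (T (r - s)) (T s x)).det * (fderiv ℝ (T s) x).det := by
      funext r
      have : T r = T (r - s) ∘ T s := funext fun y => by
        rw [Function.comp_apply, ← hT.add hξ hξc, sub_add_cancel]
      conv_lhs => rw [this, fderiv_comp x (hd _ _) (hd _ _)]
      simp only [ContinuousLinearMap.det, ContinuousLinearMap.toLinearMap_comp,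
        LinearMap.det_comp]
    rw [e]
    exact (HasDerivAt.comp_sub_const (f := fun r => (fderiv ℝ (T r) (T s x)).det) s s
      (by simpa using h0 (T s x))).mul_const _
  -- det DT_r and exp ℓ_r solve the same linear equation, so their quotient is constant. Its value
  -- at time 0 is 1.
  have h2 : ∀ s, HasDerivAt
      (fun r => (fderiv ℝ (T r) x).det * Real.exp (-logJacobian ξ T r x)) 0 s := by
    intro s
    refine ((h1 s).mul (hT.hasDerivAt_logJacobian hξ s x).neg.exp).congr_deriv ?_
    ring
  have h3 := is_const_of_deriv_eq_zero (fun s => (h2 s).differentiableAt) (fun s => (h2 s).deriv)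
    t 0
  simp only [hT0, fderiv_id, logJacobian_zero, neg_zero, Real.exp_zero, mul_one] at h3
  rw [Real.exp_neg] at h3
  have h4 : (ContinuousLinearMap.id ℝ (Space d)).det = 1 := by
    simp [ContinuousLinearMap.det]
  rw [h4, mul_inv_eq_one₀ (Real.exp_pos _).ne'] at h3
  exact h3

/-- The space derivative of the logarithm of the Jacobian determinant of the flow. -/
noncomputable def dLogJacobian (ξ : Space d → Space d) (T : ℝ → Space d → Space d) (t : ℝ)
    (x : Space d) : Space d →L[ℝ] ℝ :=
  ∫ s in (0 : ℝ)..t, fderiv ℝ (divergence ξ) (T s x) ∘L fderiv ℝ (T s) x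

theorem continuous_fderiv_divergence (hξ : ContDiff ℝ ∞ ξ) :
    Continuous (fderiv ℝ (divergence ξ)) :=
  (contDiff_divergence hξ).continuous_fderiv (by simp)

theorem IsFlow.continuous_fderiv_time (hT : IsFlow ξ T) (hξ : ContDiff ℝ ∞ ξ)
    (hξc : HasCompactSupport ξ) (x : Space d) : Continuous fun s => fderiv ℝ (T s) x :=
  continuous_iff_continuousAt.2 fun t => (hT.hasDerivAt_fderiv hξ hξc t x).continuousAt

theorem IsFlow.continuous_dLogJacobian_integrand (hT : IsFlow ξ T) (hξ : ContDiff ℝ ∞ ξ)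
    (hξc : HasCompactSupport ξ) (x : Space d) :
    Continuous fun s => fderiv ℝ (divergence ξ) (T s x) ∘L fderiv ℝ (T s) x :=
  ((continuous_fderiv_divergence hξ).comp (hT.continuous_time x)).clm_comp
    (hT.continuous_fderiv_time hξ hξc x)

theorem exists_norm_fderiv_divergence_le (hξ : ContDiff ℝ ∞ ξ) (hξc : HasCompactSupport ξ) :
    ∃ C, 0 ≤ C ∧ ∀ y, ‖fderiv ℝ (divergence ξ) y‖ ≤ C := by
  obtain ⟨C, hC⟩ := ((hasCompactSupport_divergence hξc).fderiv ℝ).exists_bound_of_continuous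
    (continuous_fderiv_divergence hξ)
  exact ⟨C, (norm_nonneg _).trans (hC 0), hC⟩

theorem IsFlow.exists_norm_dLogJacobian_integrand_le (hT : IsFlow ξ T) (hξ : ContDiff ℝ ∞ ξ)
    (hξc : HasCompactSupport ξ) (r : ℝ) :
    ∃ C, 0 ≤ C ∧ ∀ s x, |s| ≤ r →
      ‖fderiv ℝ (divergence ξ) (T s x) ∘L fderiv ℝ (T s) x‖ ≤ C := by
  obtain ⟨C, hC0, hC⟩ := exists_norm_fderiv_divergence_le hξ hξc
  obtain ⟨K, hK⟩ := exists_lipschitzWith hξ hξc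
  refine ⟨C * Real.exp (K * r), by positivity, fun s x hs => ?_⟩
  refine (ContinuousLinearMap.opNorm_comp_le _ _).trans ?_
  refine mul_le_mul (hC _) ((hT.norm_fderiv_le hK s x).trans ?_) (norm_nonneg _) hC0
  exact Real.exp_le_exp.2 (by gcongr)

theorem abs_le_abs_of_mem_uIoc {s t : ℝ} (hs : s ∈ Set.uIoc 0 t) : |s| ≤ |t| := by
  rcases Set.mem_uIoc.1 hs with h | h
  · rw [abs_of_pos h.1, abs_of_pos (h.1.trans_le h.2)]; exact h.2
  · rw [abs_of_nonpos h.2, abs_of_neg (h.1.trans_le h.2)]; linarith [h.1]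

/-- Differentiating under the time integral uses only the first space derivative of the flow. The
Jacobian determinant thus becomes differentiable in space without any second derivative of T_t. -/
theorem IsFlow.hasFDerivAt_logJacobian (hT : IsFlow ξ T) (hξ : ContDiff ℝ ∞ ξ)
    (hξc : HasCompactSupport ξ) (t : ℝ) (x : Space d) :
    HasFDerivAt (logJacobian ξ T t) (dLogJacobian ξ T t x) x := by
  obtain ⟨C, -, hC⟩ := hT.exists_norm_dLogJacobian_integrand_le hξ hξc |t|
  refine intervalIntegral.hasFDerivAt_integral_of_dominated_of_fderiv_le
    (F := fun x s => divergence ξ (T s x))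
    (F' := fun x s => fderiv ℝ (divergence ξ) (T s x) ∘L fderiv ℝ (T s) x)
    (bound := fun _ => C) Filter.univ_mem
    (Filter.Eventually.of_forall fun y => (hT.continuous_divergence hξ y).aestronglyMeasurable)
    ((hT.continuous_divergence hξ x).intervalIntegrable _ _)
    (hT.continuous_dLogJacobian_integrand hξ hξc x).aestronglyMeasurable
    (Filter.Eventually.of_forall fun s hs y _ => hC s y (abs_le_abs_of_mem_uIoc hs))
    intervalIntegrable_const
    (Filter.Eventually.of_forall fun s _ y _ => ?_)
  exact (((contDiff_divergence hξ).differentiable (by simp)) _).hasFDerivAt.comp y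
    ((hT.contDiff hξ hξc s).differentiable one_ne_zero y).hasFDerivAt

theorem IsFlow.continuous_dLogJacobian (hT : IsFlow ξ T) (hξ : ContDiff ℝ ∞ ξ)
    (hξc : HasCompactSupport ξ) (t : ℝ) : Continuous (dLogJacobian ξ T t) := by
  obtain ⟨C, -, hC⟩ := hT.exists_norm_dLogJacobian_integrand_le hξ hξc |t|
  refine intervalIntegral.continuous_of_dominated_interval (bound := fun _ => C)
    (fun x => (hT.continuous_dLogJacobian_integrand hξ hξc x).aestronglyMeasurable)
    (fun y => Filter.Eventually.of_forall fun s hs => hC s y (abs_le_abs_of_mem_uIoc hs))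
    intervalIntegrable_const
    (Filter.Eventually.of_forall fun s _ => ?_)
  exact ((continuous_fderiv_divergence hξ).comp (hT.contDiff hξ hξc s).continuous).clm_comp
    ((hT.contDiff hξ hξc s).continuous_fderiv one_ne_zero)

theorem IsFlow.contDiff_logJacobian (hT : IsFlow ξ T) (hξ : ContDiff ℝ ∞ ξ)
    (hξc : HasCompactSupport ξ) (t : ℝ) : ContDiff ℝ 1 (logJacobian ξ T t) := by
  refine contDiff_one_iff_fderiv.2
    ⟨fun x => (hT.hasFDerivAt_logJacobian hξ hξc t x).differentiableAt, ?_⟩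
  have : fderiv ℝ (logJacobian ξ T t) = dLogJacobian ξ T t :=
    funext fun x => (hT.hasFDerivAt_logJacobian hξ hξc t x).fderiv
  rw [this]
  exact hT.continuous_dLogJacobian hξ hξc t

/-- `|log det DTₜ| ≤ C |t|`. -/
theorem exists_abs_logJacobian_le (T : ℝ → Space d → Space d) (hξ : ContDiff ℝ ∞ ξ)
    (hξc : HasCompactSupport ξ) :
    ∃ C, 0 ≤ C ∧ ∀ t x, |logJacobian ξ T t x| ≤ C * |t| := by
  obtain ⟨C, hC⟩ := (hasCompactSupport_divergence hξc).exists_bound_of_continuous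
    (contDiff_divergence hξ).continuous
  refine ⟨C, (norm_nonneg _).trans (hC 0), fun t x => ?_⟩
  have h := intervalIntegral.norm_integral_le_of_norm_le_const (a := (0 : ℝ)) (b := t)
    (f := fun s => divergence ξ (T s x)) (C := C) (fun s _ => hC _)
  simpa [logJacobian] using h

/-- `‖D log det DTₜ‖ ≤ C |t|` for bounded times. -/
theorem IsFlow.exists_norm_dLogJacobian_le (hT : IsFlow ξ T) (hξ : ContDiff ℝ ∞ ξ)
    (hξc : HasCompactSupport ξ) (r : ℝ) :
    ∃ C, 0 ≤ C ∧ ∀ t x, |t| ≤ r → ‖dLogJacobian ξ T t x‖ ≤ C * |t| := by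
  obtain ⟨C, hC0, hC⟩ := hT.exists_norm_dLogJacobian_integrand_le hξ hξc r
  refine ⟨C, hC0, fun t x ht => ?_⟩
  have h := intervalIntegral.norm_integral_le_of_norm_le_const (a := (0 : ℝ)) (b := t)
    (f := fun s => fderiv ℝ (divergence ξ) (T s x) ∘L fderiv ℝ (T s) x) (C := C)
    (fun s hs => hC _ _ ((abs_le_abs_of_mem_uIoc hs).trans ht))
  simpa [dLogJacobian] using h

theorem IsFlow.hasDerivAt_dLogJacobian_zero (hT : IsFlow ξ T) (hξ : ContDiff ℝ ∞ ξ)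
    (hξc : HasCompactSupport ξ) (x : Space d) :
    HasDerivAt (fun t => dLogJacobian ξ T t x) (fderiv ℝ (divergence ξ) x) 0 := by
  have h := (hT.continuous_dLogJacobian_integrand hξ hξc x).integral_hasStrictDerivAt 0 0
    |>.hasDerivAt
  have hT0 : T 0 = id := funext hT.1
  simp only [hT0, fderiv_id, id, ContinuousLinearMap.comp_id] at h
  exact h

/-- The change of variables `y = T₋ₜ x`. -/
theorem IsFlow.map_neg_volume (hT : IsFlow ξ T) (hξ : ContDiff ℝ ∞ ξ)
    (hξc : HasCompactSupport ξ) (t : ℝ) :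
    Measure.map (T (-t)) (volume : Measure (Space d)) =
      volume.withDensity fun x => ENNReal.ofReal (Real.exp (logJacobian ξ T t x)) := by
  have hinj : Set.InjOn (T t) Set.univ :=
    (Function.LeftInverse.injective (hT.neg_apply_self hξ hξc t)).injOn
  have hsurj : Set.range (T t) = Set.univ :=
    (Function.RightInverse.surjective (hT.apply_neg_self hξ hξc t)).range_eq
  have h := map_withDensity_abs_det_fderiv_eq_addHaar (volume : Measure (Space d))
    (s := Set.univ) (f := T t) (f' := fun x => fderiv ℝ (T t) x) nullMeasurableSet_univ
    (fun x _ => ((hT.contDiff hξ hξc t).differentiable one_ne_zero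
      x).hasFDerivAt.hasFDerivWithinAt) hinj
  simp only [hT.det_fderiv hξ hξc, abs_of_pos (Real.exp_pos _), Measure.restrict_univ,
    Set.image_univ, hsurj] at h
  have hm : ∀ s, Measurable (T s) := fun s => (hT.contDiff hξ hξc s).continuous.measurable
  -- By `h`, Lebesgue measure is the image under T_t of the measure with density exp ℓ_t; T_{-t}
  -- undoes this image.
  conv_lhs => rw [← h]
  rw [Measure.map_map (hm _) (hm _)]
  have : T (-t) ∘ T t = id := funext (hT.neg_apply_self hξ hξc t)
  rw [this, Measure.map_id]

end DirichletVariation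

/-! ### Mollification, and testing weak gradients against continuous fields. -/

namespace DirichletVariation

open scoped Convolution

open ContinuousLinearMap (lsmul)

variable {d : ℕ}

theorem locallyIntegrable_coord {g : Space d → Space d} (hg : LocallyIntegrable g) (i : Fin d) :
    LocallyIntegrable fun x => g x i := fun x => by
  obtain ⟨s, hs, h⟩ := hg x
  exact ⟨s, hs, (EuclideanSpace.proj (𝕜 := ℝ) i).integrable_comp h⟩

theorem integrable_mul_of_hasCompactSupport {h k : Space d → ℝ} (hh : LocallyIntegrable h)
    (hk : Continuous k) (hkc : HasCompactSupport k) : Integrable fun x => h x * k x := by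
  simpa [mul_comm] using hh.integrable_smul_left_of_hasCompactSupport hk hkc

/-- A shrinking sequence of bump functions. -/
noncomputable def bumpSeq (d n : ℕ) : ContDiffBump (0 : Space d) where
  rIn := 1 / (n + 2)
  rOut := 1 / (n + 1)
  rIn_pos := by positivity
  rIn_lt_rOut := by gcongr; norm_num

/-- The mollification of `k` at scale `1 / (n + 1)`. -/
noncomputable def mollify (n : ℕ) (k : Space d → ℝ) : Space d → ℝ :=
  (bumpSeq d n).normed volume ⋆[lsmul ℝ ℝ, volume] k

theorem mollify_apply (n : ℕ) (k : Space d → ℝ) (x : Space d) :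
    mollify n k x = ∫ y, (bumpSeq d n).normed volume (x - y) * k y := by
  rw [mollify, convolution_eq_swap]
  rfl

theorem contDiff_mollify (n : ℕ) {k : Space d → ℝ} (hk : Continuous k) :
    ContDiff ℝ ∞ (mollify n k) :=
  (bumpSeq d n).hasCompactSupport_normed.contDiff_convolution_left _
    (bumpSeq d n).contDiff_normed hk.locallyIntegrable

theorem hasCompactSupport_mollify (n : ℕ) {k : Space d → ℝ} (hkc : HasCompactSupport k) :
    HasCompactSupport (mollify n k) :=
  HasCompactSupport.convolution _ (bumpSeq d n).hasCompactSupport_normed hkc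

theorem tendsto_mollify {k : Space d → ℝ} (hk : Continuous k) (x : Space d) :
    Filter.Tendsto (fun n => mollify n k x) Filter.atTop (nhds (k x)) :=
  ContDiffBump.convolution_tendsto_right_of_continuous (φ := fun n => bumpSeq d n)
    tendsto_one_div_add_atTop_nhds_zero_nat hk x

theorem norm_mollify_le (n : ℕ) {k : Space d → ℝ} (hk : Continuous k) {C : ℝ}
    (hC : ∀ x, ‖k x‖ ≤ C) (x : Space d) : ‖mollify n k x‖ ≤ 3 * C := by
  -- `k` oscillates by at most 2C, so the mollification differs from it by at most 2C, giving 3C in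
  -- total. Only uniformity in n matters.
  have h := (bumpSeq d n).dist_normed_convolution_le (μ := volume) (g := k) (x₀ := x) (ε := 2 * C)
    hk.aestronglyMeasurable fun y _ => by
      rw [dist_eq_norm]
      linarith [norm_sub_le (k y) (k x), hC y, hC x]
  rw [dist_eq_norm] at h
  have h1 := norm_le_norm_add_norm_sub' (mollify n k x) (k x)
  have h2 := hC x
  unfold mollify at h1 ⊢
  linarith

/-- All scales 1/(n+1) are at most 1, so one compact set serves every n in the dominated convergence
argument. -/
theorem support_mollify_subset (n : ℕ) (k : Space d → ℝ) :
    Function.support (mollify n k) ⊆ Metric.cthickening 1 (tsupport k) := by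
  intro x hx
  obtain ⟨y, hy, z, hz, rfl⟩ := Set.mem_add.1 (support_convolution_subset _ hx)
  rw [ContDiffBump.support_normed_eq, mem_ball_zero_iff] at hy
  refine Metric.mem_cthickening_of_dist_le _ z _ _ (subset_tsupport _ hz) ?_
  rw [dist_eq_norm, add_sub_cancel_right]
  refine hy.le.trans ?_
  change (1 : ℝ) / (n + 1) ≤ 1
  rw [div_le_one (by positivity)]
  linarith [(Nat.cast_nonneg n : (0 : ℝ) ≤ n)]

theorem tendsto_integral_mul_mollify {h k : Space d → ℝ} (hh : LocallyIntegrable h)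
    (hk : Continuous k) (hkc : HasCompactSupport k) :
    Filter.Tendsto (fun n => ∫ x, h x * mollify n k x) Filter.atTop
      (nhds (∫ x, h x * k x)) := by
  obtain ⟨C, hC⟩ := hkc.exists_bound_of_continuous hk
  have hS : IsCompact (Metric.cthickening 1 (tsupport k)) := IsCompact.cthickening hkc
  refine tendsto_integral_of_dominated_convergence
    (fun x => (Metric.cthickening 1 (tsupport k)).indicator (fun x => ‖h x‖ * (3 * C)) x)
    (fun n => (integrable_mul_of_hasCompactSupport hh (contDiff_mollify n hk).continuous
      (hasCompactSupport_mollify n hkc)).aestronglyMeasurable)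
    ?_ (fun n => Filter.Eventually.of_forall fun x => ?_)
    (Filter.Eventually.of_forall fun x => (tendsto_mollify hk x).const_mul _)
  · rw [integrable_indicator_iff hS.measurableSet]
    exact (hh.integrableOn_isCompact hS).norm.mul_const _
  · by_cases hx : x ∈ Metric.cthickening 1 (tsupport k)
    · rw [Set.indicator_of_mem hx, norm_mul]
      gcongr
      exact norm_mollify_le n hk hC x
    · rw [Set.indicator_of_notMem hx, Function.notMem_support.1
        fun hx' => hx (support_mollify_subset n k hx')]
      simp

theorem fderiv_mollify (n : ℕ) {k : Space d → ℝ} (hk : Continuous k) (x v : Space d) :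
    fderiv ℝ (mollify n k) x v =
      ∫ y, fderiv ℝ ((bumpSeq d n).normed volume) (x - y) v * k y := by
  have hc := (bumpSeq d n).hasCompactSupport_normed (μ := volume)
  have hs : ContDiff ℝ 1 ((bumpSeq d n).normed volume) := (bumpSeq d n).contDiff_normed
  have h := hc.hasFDerivAt_convolution_left (lsmul ℝ ℝ) hs
    (hk.locallyIntegrable (μ := volume)) x
  have e : fderiv ℝ (mollify n k) x = _ := h.fderiv
  rw [e, convolution_eq_swap, ContinuousLinearMap.integral_apply]
  · rfl
  · have := ((hc.fderiv ℝ).convolutionExists_left ((lsmul ℝ ℝ).precompL (Space d))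
      (hs.continuous_fderiv one_ne_zero) (hk.locallyIntegrable (μ := volume)) x).integrable_swap
    exact this

/-- If `f₀ = div f` weakly for continuous compactly supported `f₀`, `f`, then
`∫ u f₀ = - ∫ ∇u · f` for every weakly differentiable `u`. -/
theorem IsWeakGradient.integral_mul_add_inner_eq_zero {u : Space d → ℝ} {g : Space d → Space d}
    (hg : IsWeakGradient u g) {f₀ : Space d → ℝ} {f : Space d → Space d}
    (hf₀ : Continuous f₀) (hf₀c : HasCompactSupport f₀) (hf : Continuous f)
    (hfc : HasCompactSupport f)
    (h : ∀ w : Space d → ℝ, ContDiff ℝ ∞ w → HasCompactSupport w →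
      ∫ x, (w x * f₀ x + fderiv ℝ w x (f x)) = 0) :
    ∫ x, u x * f₀ x = - ∑ i, ∫ x, g x i * f x i := by
  have hfi : ∀ i, Continuous fun x => f x i := fun i =>
    (EuclideanSpace.proj (𝕜 := ℝ) i).continuous.comp hf
  have hfic : ∀ i, HasCompactSupport fun x => f x i := fun i =>
    hfc.comp_left (g := fun v : Space d => v i) rfl
  -- Divergence commutes with mollification: the hypothesis is tested with the reflected bump w(y) =
  -- ρₙ(x - y), whose derivative carries a minus sign.
  have hdiv : ∀ n x, ∑ i, fderiv ℝ (mollify n fun y => f y i) x (stdVec i) = mollify n f₀ x := by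
    intro n x
    have hc := (bumpSeq d n).hasCompactSupport_normed (μ := volume)
    have hs : ContDiff ℝ ∞ ((bumpSeq d n).normed volume) := (bumpSeq d n).contDiff_normed
    have hws : ContDiff ℝ ∞ fun y => (bumpSeq d n).normed volume (x - y) :=
      hs.comp (contDiff_const.sub contDiff_id)
    have hwc : HasCompactSupport fun y => (bumpSeq d n).normed volume (x - y) :=
      hc.comp_homeomorph (Homeomorph.subLeft x)
    have hw := h _ hws hwc
    have hfd : ∀ y, fderiv ℝ (fun y => (bumpSeq d n).normed volume (x - y)) y =
        - fderiv ℝ ((bumpSeq d n).normed volume) (x - y) := fun y => by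
      have := (hs.differentiable (by simp) (x - y)).hasFDerivAt.comp y
        ((hasFDerivAt_id y).const_sub x)
      rw [ContinuousLinearMap.comp_neg, ContinuousLinearMap.comp_id] at this
      exact this.fderiv
    have hi1 : ∀ i, Integrable fun y =>
        fderiv ℝ ((bumpSeq d n).normed volume) (x - y) (stdVec i) * f y i := fun i => by
      refine integrable_mul_of_hasCompactSupport (Continuous.locallyIntegrable ?_) (hfi i) (hfic i)
      exact ((hs.continuous_fderiv (by simp)).comp
        (continuous_const.sub continuous_id)).clm_apply continuous_const
    have hsum : ∀ y, ∑ i, fderiv ℝ ((bumpSeq d n).normed volume) (x - y) (stdVec i) * f y i =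
        fderiv ℝ ((bumpSeq d n).normed volume) (x - y) (f y) := fun y => by
      conv_rhs => rw [← (EuclideanSpace.basisFun (Fin d) ℝ).sum_repr (f y)]
      simp [stdVec, mul_comm]
    simp only [fderiv_mollify n (hfi _)]
    rw [← integral_finsetSum _ fun i _ => hi1 i]
    simp only [hsum]
    rw [mollify_apply]
    have hi2 : Integrable fun y => fderiv ℝ ((bumpSeq d n).normed volume) (x - y) (f y) := by
      simp only [← hsum]
      exact integrable_finsetSum _ fun i _ => hi1 i
    have hi3 : Integrable fun y => (bumpSeq d n).normed volume (x - y) * f₀ y :=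
      integrable_mul_of_hasCompactSupport hws.continuous.locallyIntegrable hf₀ hf₀c
    simp only [hfd, _root_.neg_apply] at hw
    rw [integral_add hi3 hi2.fun_neg, integral_neg] at hw
    linarith
  -- The mollified components are smooth with compact support, hence admissible in the definition of
  -- the weak gradient.
  have hn : ∀ n, ∫ x, u x * mollify n f₀ x = - ∑ i, ∫ x, g x i * mollify n (fun y => f y i) x := by
    intro n
    simp only [← hdiv, Finset.mul_sum]
    rw [integral_finsetSum, ← Finset.sum_neg_distrib]
    · exact Finset.sum_congr rfl fun i _ => hg.2.2 _ (contDiff_mollify n (hfi i))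
        (hasCompactSupport_mollify n (hfic i)) i
    · intro i _
      refine integrable_mul_of_hasCompactSupport hg.1 ?_ ?_
      · exact ((contDiff_mollify n (hfi i)).continuous_fderiv (by simp)).clm_apply
          continuous_const
      · exact (hasCompactSupport_mollify n (hfic i)).fderiv_apply ℝ _
  refine tendsto_nhds_unique (tendsto_integral_mul_mollify hg.1 hf₀ hf₀c) ?_
  simp only [hn]
  exact (tendsto_finsetSum _ fun i _ =>
    tendsto_integral_mul_mollify (locallyIntegrable_coord hg.2.1 i) (hfi i) (hfic i)).neg

end DirichletVariation

/-! ### Transport of H¹ functions by the flow, and the weak chain rule. -/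

namespace DirichletVariation

variable {d : ℕ} {ξ : Space d → Space d} {T : ℝ → Space d → Space d}

/-- The inverse `(DTₜ(y))⁻¹`, written as the derivative of `T₋ₜ` at `Tₜ y`. -/
noncomputable def invDeriv (T : ℝ → Space d → Space d) (t : ℝ) (y : Space d) :
    Space d →L[ℝ] Space d :=
  fderiv ℝ (T (-t)) (T t y)

/-- The `i`-th component of `det DTₜ · (∇uₜ ∘ Tₜ)`, where `uₜ = (Tₜ)_♯ u` and `g = ∇u`. -/
noncomputable def pullGradCoord (ξ : Space d → Space d) (T : ℝ → Space d → Space d) (t : ℝ)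
    (u : Space d → ℝ) (g : Space d → Space d) (i : Fin d) (y : Space d) : ℝ :=
  inner ℝ (g y) (invDeriv T t y (stdVec i)) - u y * dLogJacobian ξ T t y (invDeriv T t y (stdVec i))

/-- The density `u / det DTₜ` composed with `T₋ₜ`, that is, the push-forward of `u` under `Tₜ`. -/
noncomputable def pushDensity (ξ : Space d → Space d) (T : ℝ → Space d → Space d) (t : ℝ)
    (u : Space d → ℝ) (x : Space d) : ℝ :=
  Real.exp (-logJacobian ξ T t (T (-t) x)) * u (T (-t) x)

/-- The weak gradient of the push-forward of `u` under `Tₜ`, where `g = ∇u`. -/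
noncomputable def pushGrad (ξ : Space d → Space d) (T : ℝ → Space d → Space d) (t : ℝ)
    (u : Space d → ℝ) (g : Space d → Space d) (x : Space d) : Space d :=
  ∑ i, pushDensity ξ T t (pullGradCoord ξ T t u g i) x • stdVec i

theorem pushGrad_apply (t : ℝ) (u : Space d → ℝ) (g : Space d → Space d) (x : Space d)
    (i : Fin d) :
    pushGrad ξ T t u g x i = pushDensity ξ T t (pullGradCoord ξ T t u g i) x := by
  simp [pushGrad, stdVec, Pi.single_apply]

theorem IsFlow.continuous_invDeriv (hT : IsFlow ξ T) (hξ : ContDiff ℝ ∞ ξ)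
    (hξc : HasCompactSupport ξ) (t : ℝ) : Continuous (invDeriv T t) :=
  ((hT.contDiff hξ hξc (-t)).continuous_fderiv one_ne_zero).comp
    (hT.contDiff hξ hξc t).continuous

theorem IsFlow.norm_invDeriv_le {K : NNReal} (hT : IsFlow ξ T) (hK : LipschitzWith K ξ) (t : ℝ)
    (y : Space d) : ‖invDeriv T t y‖ ≤ Real.exp (K * |t|) := by
  simpa [invDeriv] using hT.norm_fderiv_le hK (-t) (T t y)

/-- The flow as a homeomorphism. -/
noncomputable def IsFlow.homeomorph (hT : IsFlow ξ T) (hξ : ContDiff ℝ ∞ ξ)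
    (hξc : HasCompactSupport ξ) (t : ℝ) : Space d ≃ₜ Space d where
  toFun := T t
  invFun := T (-t)
  left_inv := hT.neg_apply_self hξ hξc t
  right_inv := hT.apply_neg_self hξ hξc t
  continuous_toFun := (hT.contDiff hξ hξc t).continuous
  continuous_invFun := (hT.contDiff hξ hξc (-t)).continuous

theorem IsFlow.hasCompactSupport_comp {F : Type*} [Zero F] (hT : IsFlow ξ T)
    (hξ : ContDiff ℝ ∞ ξ) (hξc : HasCompactSupport ξ) (t : ℝ) {k : Space d → F}
    (hk : HasCompactSupport k) : HasCompactSupport fun y => k (T t y) :=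
  hk.comp_homeomorph (hT.homeomorph hξ hξc t)

/-- The change of variables `x = Tₜ y`. -/
theorem IsFlow.integral_exp_smul_comp {F : Type*} [NormedAddCommGroup F] [NormedSpace ℝ F]
    (hT : IsFlow ξ T) (hξ : ContDiff ℝ ∞ ξ) (hξc : HasCompactSupport ξ) (t : ℝ)
    (f : Space d → F) :
    ∫ y, Real.exp (logJacobian ξ T t y) • f (T t y) = ∫ x, f x := by
  have h := integral_image_eq_integral_abs_det_fderiv_smul (volume : Measure (Space d))
    (s := Set.univ) (f := T t) (f' := fun x => fderiv ℝ (T t) x) MeasurableSet.univ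
    (fun x _ => ((hT.contDiff hξ hξc t).differentiable one_ne_zero
      x).hasFDerivAt.hasFDerivWithinAt) (hT.homeomorph hξ hξc t).injective.injOn f
  have hsurj : Set.range (T t) = Set.univ := (hT.homeomorph hξ hξc t).surjective.range_eq
  simp only [hT.det_fderiv hξ hξc, abs_of_pos (Real.exp_pos _), Measure.restrict_univ,
    Set.image_univ, hsurj] at h
  exact h.symm

theorem IsFlow.pushDensity_apply (hT : IsFlow ξ T) (hξ : ContDiff ℝ ∞ ξ)
    (hξc : HasCompactSupport ξ) (t : ℝ) (u : Space d → ℝ) (y : Space d) :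
    pushDensity ξ T t u (T t y) = Real.exp (-logJacobian ξ T t y) * u y := by
  rw [pushDensity, hT.neg_apply_self hξ hξc]

theorem IsFlow.integral_pushDensity_mul (hT : IsFlow ξ T) (hξ : ContDiff ℝ ∞ ξ)
    (hξc : HasCompactSupport ξ) (t : ℝ) (u ζ : Space d → ℝ) :
    ∫ x, pushDensity ξ T t u x * ζ x = ∫ y, u y * ζ (T t y) := by
  rw [← hT.integral_exp_smul_comp hξ hξc t]
  refine integral_congr_ae (Filter.Eventually.of_forall fun y => ?_)
  simp only [hT.pushDensity_apply hξ hξc, smul_eq_mul, Real.exp_neg]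
  have := (Real.exp_pos (logJacobian ξ T t y)).ne'
  field_simp

/-- The image of Lebesgue measure under T_{-t} has density exp ℓ_t ≤ exp(C|t|), so composition is
bounded on every Lᵖ. -/
theorem IsFlow.memLp_comp_neg {F : Type*} [NormedAddCommGroup F] (hT : IsFlow ξ T)
    (hξ : ContDiff ℝ ∞ ξ) (hξc : HasCompactSupport ξ) (t : ℝ) {f : Space d → F} {p : ENNReal}
    (hf : MemLp f p) : MemLp (fun x => f (T (-t) x)) p := by
  obtain ⟨C, -, hC⟩ := exists_abs_logJacobian_le T hξ hξc
  have hle : Measure.map (T (-t)) (volume : Measure (Space d)) ≤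
      ENNReal.ofReal (Real.exp (C * |t|)) • volume := by
    rw [hT.map_neg_volume hξ hξc, ← withDensity_const]
    refine withDensity_mono (Filter.Eventually.of_forall fun y => ?_)
    exact ENNReal.ofReal_le_ofReal (Real.exp_le_exp.2 ((le_abs_self _).trans (hC t y)))
  exact (hf.of_measure_le_smul ENNReal.ofReal_ne_top hle).comp_of_map
    (hT.contDiff hξ hξc (-t)).continuous.aemeasurable

theorem IsFlow.memLp_pushDensity (hT : IsFlow ξ T) (hξ : ContDiff ℝ ∞ ξ)
    (hξc : HasCompactSupport ξ) (t : ℝ) {u : Space d → ℝ} {p : ENNReal} (hu : MemLp u p) :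
    MemLp (pushDensity ξ T t u) p := by
  obtain ⟨C, -, hC⟩ := exists_abs_logJacobian_le T hξ hξc
  refine hT.memLp_comp_neg hξ hξc t (f := fun y => Real.exp (-logJacobian ξ T t y) * u y) ?_
  refine hu.of_le_mul (c := Real.exp (C * |t|)) ?_ (Filter.Eventually.of_forall fun y => ?_)
  · exact (Real.continuous_exp.comp
      (hT.contDiff_logJacobian hξ hξc t).continuous.neg).aestronglyMeasurable.mul hu.1
  · rw [norm_mul, Real.norm_of_nonneg (Real.exp_pos _).le]
    gcongr
    exact (neg_le_abs _).trans (hC t y)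

theorem IsFlow.aestronglyMeasurable_pullGradCoord (hT : IsFlow ξ T) (hξ : ContDiff ℝ ∞ ξ)
    (hξc : HasCompactSupport ξ) (t : ℝ) {u : Space d → ℝ} {g : Space d → Space d}
    (hu : AEStronglyMeasurable u) (hg : AEStronglyMeasurable g) (i : Fin d) :
    AEStronglyMeasurable (pullGradCoord ξ T t u g i) := by
  have hB : Continuous fun y => invDeriv T t y (stdVec i) :=
    (hT.continuous_invDeriv hξ hξc t).clm_apply continuous_const
  exact (hg.inner hB.aestronglyMeasurable).sub (hu.mul
    ((hT.continuous_dLogJacobian hξ hξc t).clm_apply hB).aestronglyMeasurable)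

theorem norm_stdVec (i : Fin d) : ‖stdVec i‖ = 1 := by
  simp [stdVec]

theorem inner_stdVec (v : Space d) (i : Fin d) : inner ℝ v (stdVec i) = v i := by
  simp [stdVec, EuclideanSpace.inner_single_right]

/-- A bound of the transported gradient, uniform for bounded times. -/
theorem IsFlow.exists_abs_pullGradCoord_le (hT : IsFlow ξ T) (hξ : ContDiff ℝ ∞ ξ)
    (hξc : HasCompactSupport ξ) (r : ℝ) :
    ∃ C, 0 ≤ C ∧ ∀ t, |t| ≤ r → ∀ (u : Space d → ℝ) (g : Space d → Space d) i y,
      |pullGradCoord ξ T t u g i y| ≤ C * (‖g y‖ + |u y|) := by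
  obtain ⟨K, hK⟩ := exists_lipschitzWith hξ hξc
  obtain ⟨C, hC0, hC⟩ := hT.exists_norm_dLogJacobian_le hξ hξc r
  refine ⟨Real.exp (K * r) * (1 + C * |r|), by positivity, fun t ht u g i y => ?_⟩
  have hB : ‖invDeriv T t y (stdVec i)‖ ≤ Real.exp (K * r) := by
    have h1 := (invDeriv T t y).le_opNorm (stdVec i)
    rw [norm_stdVec, mul_one] at h1
    exact h1.trans ((hT.norm_invDeriv_le hK t y).trans (Real.exp_le_exp.2 (by gcongr)))
  have h1 : |inner ℝ (g y) (invDeriv T t y (stdVec i))| ≤ ‖g y‖ * Real.exp (K * r) :=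
    (abs_real_inner_le_norm _ _).trans (by gcongr)
  have h2 : |dLogJacobian ξ T t y (invDeriv T t y (stdVec i))| ≤ C * |r| * Real.exp (K * r) := by
    refine ((dLogJacobian ξ T t y).le_opNorm _).trans ?_
    refine mul_le_mul ((hC t y ht).trans ?_) hB (norm_nonneg _) (by positivity)
    exact mul_le_mul_of_nonneg_left (ht.trans (le_abs_self r)) hC0
  calc |pullGradCoord ξ T t u g i y|
      ≤ |inner ℝ (g y) (invDeriv T t y (stdVec i))| +
        |u y| * |dLogJacobian ξ T t y (invDeriv T t y (stdVec i))| := by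
        rw [← abs_mul]; exact abs_sub _ _
    _ ≤ ‖g y‖ * Real.exp (K * r) + |u y| * (C * |r| * Real.exp (K * r)) := by gcongr
    _ ≤ _ := by
        have e1 : 0 ≤ ‖g y‖ * Real.exp (K * r) * (C * |r|) := by positivity
        have e2 : 0 ≤ |u y| * Real.exp (K * r) := by positivity
        nlinarith

theorem IsFlow.memLp_pullGradCoord (hT : IsFlow ξ T) (hξ : ContDiff ℝ ∞ ξ)
    (hξc : HasCompactSupport ξ) (t : ℝ) {u : Space d → ℝ} {g : Space d → Space d} {p : ENNReal}
    (hu : MemLp u p) (hg : MemLp g p) (i : Fin d) : MemLp (pullGradCoord ξ T t u g i) p := by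
  obtain ⟨C, -, hC⟩ := hT.exists_abs_pullGradCoord_le hξ hξc |t|
  refine (hg.norm.add hu.norm).of_le_mul (c := C)
    (hT.aestronglyMeasurable_pullGradCoord hξ hξc t hu.1 hg.1 i)
    (Filter.Eventually.of_forall fun y => ?_)
  have h := hC t le_rfl u g i y
  simp only [Real.norm_eq_abs, Pi.add_apply]
  rwa [abs_of_nonneg (a := ‖g y‖ + |u y|) (by positivity)]

theorem IsFlow.memLp_pushGrad (hT : IsFlow ξ T) (hξ : ContDiff ℝ ∞ ξ)
    (hξc : HasCompactSupport ξ) (t : ℝ) {u : Space d → ℝ} {g : Space d → Space d} {p : ENNReal}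
    (hu : MemLp u p) (hg : MemLp g p) : MemLp (pushGrad ξ T t u g) p := by
  refine memLp_finsetSum (f := fun i x =>
    pushDensity ξ T t (pullGradCoord ξ T t u g i) x • (stdVec i : Space d)) _ fun i _ => ?_
  have h := hT.memLp_pushDensity hξ hξc t (hT.memLp_pullGradCoord hξ hξc t hu hg i)
  refine h.of_le_mul (c := 1) (h.1.smul_const _) (Filter.Eventually.of_forall fun x => ?_)
  rw [norm_smul, norm_stdVec, mul_one, one_mul]

/-- The classical chain rule, tested against a smooth function. -/
theorem IsFlow.integral_test_eq_zero (hT : IsFlow ξ T) (hξ : ContDiff ℝ ∞ ξ)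
    (hξc : HasCompactSupport ξ) (t : ℝ) {φ w : Space d → ℝ} (hφ : ContDiff ℝ ∞ φ)
    (hφc : HasCompactSupport φ) (hw : ContDiff ℝ ∞ w) (v : Space d) :
    ∫ y, (w y * (fderiv ℝ φ (T t y) v - φ (T t y) * dLogJacobian ξ T t y (invDeriv T t y v)) +
      fderiv ℝ w y (φ (T t y) • invDeriv T t y v)) = 0 := by
  have hS := hT.contDiff hξ hξc (-t)
  have hℓ := hT.contDiff_logJacobian hξ hξc t
  -- For smooth w the push-forward is classically C¹, so ordinary integration by parts against φ is
  -- available.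
  have hW : ContDiff ℝ 1 (pushDensity ξ T t w) :=
    (Real.contDiff_exp.comp (hℓ.comp hS).neg).mul ((hw.of_le (by simp)).comp hS)
  have hfd : ∀ y, fderiv ℝ (pushDensity ξ T t w) (T t y) v =
      Real.exp (-logJacobian ξ T t y) * (fderiv ℝ w y (invDeriv T t y v) -
        w y * dLogJacobian ξ T t y (invDeriv T t y v)) := by
    intro y
    have h1 : HasFDerivAt (fun z => Real.exp (-logJacobian ξ T t z) * w z) _ y :=
      ((hT.hasFDerivAt_logJacobian hξ hξc t y).neg.exp).mul
        (hw.differentiable (by simp) y).hasFDerivAt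
    have h2 : HasFDerivAt (T (-t)) (invDeriv T t y) (T t y) :=
      (hS.differentiable one_ne_zero _).hasFDerivAt
    have h3 := (show HasFDerivAt (fun z => Real.exp (-logJacobian ξ T t z) * w z) _
      (T (-t) (T t y)) by rw [hT.neg_apply_self hξ hξc]; exact h1).comp (T t y) h2
    have h4 : fderiv ℝ (pushDensity ξ T t w) (T t y) = _ := h3.fderiv
    rw [h4]
    simp
    ring
  have hdφ : Continuous fun x => fderiv ℝ φ x v :=
    (hφ.continuous_fderiv (by simp)).clm_apply continuous_const
  have hdφc : HasCompactSupport fun x => fderiv ℝ φ x v := hφc.fderiv_apply ℝ v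
  have hdW : Continuous fun x => fderiv ℝ (pushDensity ξ T t w) x v :=
    (hW.continuous_fderiv one_ne_zero).clm_apply continuous_const
  have hi1 := integrable_mul_of_hasCompactSupport hdW.locallyIntegrable hφ.continuous hφc
  have hi2 := integrable_mul_of_hasCompactSupport hW.continuous.locallyIntegrable hdφ hdφc
  have hi3 := integrable_mul_of_hasCompactSupport hW.continuous.locallyIntegrable hφ.continuous hφc
  have hparts := integral_mul_fderiv_eq_neg_fderiv_mul_of_integrable hi1 hi2 hi3
    (fun x _ => hW.differentiable one_ne_zero x) (fun x _ => hφ.differentiable (by simp) x)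
  have hsum : ∫ x, (pushDensity ξ T t w x * fderiv ℝ φ x v +
      fderiv ℝ (pushDensity ξ T t w) x v * φ x) = 0 := by
    rw [integral_add hi2 hi1, hparts, neg_add_cancel]
  -- Back in the original variables, the factor exp ℓ_t cancels the exp(-ℓ_t) carried by the
  -- push-forward and its derivative.
  rw [← hT.integral_exp_smul_comp hξ hξc t] at hsum
  rw [← hsum]
  refine integral_congr_ae (Filter.Eventually.of_forall fun y => ?_)
  simp only [hfd, hT.pushDensity_apply hξ hξc, smul_eq_mul, Real.exp_neg, map_smul]
  have := (Real.exp_pos (logJacobian ξ T t y)).ne'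
  field_simp
  ring

/-- The chain rule for weak gradients along the flow. -/
theorem IsWeakGradient.integral_mul_fderiv_comp_flow {u : Space d → ℝ} {g : Space d → Space d}
    (hg : IsWeakGradient u g) (hT : IsFlow ξ T) (hξ : ContDiff ℝ ∞ ξ)
    (hξc : HasCompactSupport ξ) (t : ℝ) {φ : Space d → ℝ} (hφ : ContDiff ℝ ∞ φ)
    (hφc : HasCompactSupport φ) (i : Fin d) :
    ∫ y, u y * fderiv ℝ φ (T t y) (stdVec i) =
      - ∫ y, pullGradCoord ξ T t u g i y * φ (T t y) := by
  have hTc := (hT.contDiff hξ hξc t).continuous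
  have hB : Continuous fun y => invDeriv T t y (stdVec i) :=
    (hT.continuous_invDeriv hξ hξc t).clm_apply continuous_const
  have hL : Continuous fun y => dLogJacobian ξ T t y (invDeriv T t y (stdVec i)) :=
    (hT.continuous_dLogJacobian hξ hξc t).clm_apply hB
  have hφT : Continuous fun y => φ (T t y) := hφ.continuous.comp hTc
  have hφTc : HasCompactSupport fun y => φ (T t y) := hT.hasCompactSupport_comp hξ hξc t hφc
  have hdφ : Continuous fun y => fderiv ℝ φ (T t y) (stdVec i) :=
    ((hφ.continuous_fderiv (by simp)).comp hTc).clm_apply continuous_const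
  have hdφc : HasCompactSupport fun y => fderiv ℝ φ (T t y) (stdVec i) :=
    hT.hasCompactSupport_comp hξ hξc t (k := fun x => fderiv ℝ φ x (stdVec i))
      (hφc.fderiv_apply ℝ (stdVec i))
  have hφLc : HasCompactSupport fun y => φ (T t y) *
      dLogJacobian ξ T t y (invDeriv T t y (stdVec i)) :=
    hφTc.mul_right (f' := fun y => dLogJacobian ξ T t y (invDeriv T t y (stdVec i)))
  have hf : Continuous fun y => φ (T t y) • invDeriv T t y (stdVec i) := hφT.smul hB
  have hfc : HasCompactSupport fun y => φ (T t y) • invDeriv T t y (stdVec i) :=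
    hφTc.smul_right (f' := fun y => invDeriv T t y (stdVec i))
  -- The field `f` is only known to be continuous, since it contains (DT_t)⁻¹; its weak divergence
  -- is `f₀`.
  have key := hg.integral_mul_add_inner_eq_zero
    (f₀ := fun y => fderiv ℝ φ (T t y) (stdVec i) - φ (T t y) *
      dLogJacobian ξ T t y (invDeriv T t y (stdVec i)))
    (f := fun y => φ (T t y) • invDeriv T t y (stdVec i))
    (hdφ.sub (hφT.mul hL)) (hdφc.sub hφLc) hf hfc
    fun w hw _ => hT.integral_test_eq_zero hξ hξc t hφ hφc hw (stdVec i)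
  have hi1 := integrable_mul_of_hasCompactSupport hg.1 hdφ hdφc
  have hi2 : Integrable fun y => u y * (φ (T t y) *
      dLogJacobian ξ T t y (invDeriv T t y (stdVec i))) :=
    integrable_mul_of_hasCompactSupport hg.1 (hφT.mul hL) hφLc
  have hi3 : ∀ j ∈ Finset.univ, Integrable fun y =>
      g y j * (φ (T t y) • invDeriv T t y (stdVec i)) j := fun j _ =>
    integrable_mul_of_hasCompactSupport (locallyIntegrable_coord hg.2.1 j)
      ((EuclideanSpace.proj (𝕜 := ℝ) j).continuous.comp hf)
      (hfc.comp_left (g := fun v : Space d => v j) rfl)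
  simp only [mul_sub] at key
  rw [integral_sub hi1 hi2, ← integral_finsetSum _ hi3] at key
  have e : ∀ y, pullGradCoord ξ T t u g i y * φ (T t y) =
      (∑ j, g y j * (φ (T t y) • invDeriv T t y (stdVec i)) j) -
        u y * (φ (T t y) * dLogJacobian ξ T t y (invDeriv T t y (stdVec i))) := by
    intro y
    have : (∑ j, g y j * (φ (T t y) • invDeriv T t y (stdVec i)) j) =
        φ (T t y) * inner ℝ (g y) (invDeriv T t y (stdVec i)) := by
      rw [PiLp.inner_apply, Finset.mul_sum]
      refine Finset.sum_congr rfl fun j _ => ?_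
      simp
      ring
    rw [this, pullGradCoord]
    ring
  simp only [e]
  rw [integral_sub (integrable_finsetSum _ hi3) hi2]
  linarith

theorem IsWeakGradient.ae_eq {u : Space d → ℝ} {g h : Space d → Space d}
    (hg : IsWeakGradient u g) (hh : IsWeakGradient u h) : g =ᵐ[volume] h := by
  have : ∀ i, ∀ᵐ x, g x i = h x i := fun i => by
    refine ae_eq_of_integral_contDiff_smul_eq (locallyIntegrable_coord hg.2.1 i)
      (locallyIntegrable_coord hh.2.1 i) fun φ hφ hφc => ?_
    have h1 := hg.2.2 φ hφ hφc i
    have h2 := hh.2.2 φ hφ hφc i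
    simp only [smul_eq_mul, mul_comm (φ _)]
    linarith
  filter_upwards [ae_all_iff.2 this] with x hx
  ext i
  exact hx i

theorem IsWeakGradient.isWeakGradient_weakGrad {u : Space d → ℝ} {g : Space d → Space d}
    (hg : IsWeakGradient u g) : IsWeakGradient u (weakGrad u) := by
  have h : ∃ g : Space d → Space d, IsWeakGradient u g := ⟨g, hg⟩
  rw [weakGrad, dif_pos h]
  exact h.choose_spec

theorem IsWeakGradient.weakGrad_ae_eq {u : Space d → ℝ} {g : Space d → Space d}
    (hg : IsWeakGradient u g) : weakGrad u =ᵐ[volume] g :=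
  hg.isWeakGradient_weakGrad.ae_eq hg

theorem IsPushforward.ae_eq_pushDensity {u v : Space d → ℝ} {t : ℝ}
    (hv : IsPushforward (T t) u v) (hT : IsFlow ξ T) (hξ : ContDiff ℝ ∞ ξ)
    (hξc : HasCompactSupport ξ) (hu : MemLp u 2) : v =ᵐ[volume] pushDensity ξ T t u := by
  refine ae_eq_of_integral_contDiff_smul_eq hv.1
    ((hT.memLp_pushDensity hξ hξc t hu).locallyIntegrable (by norm_num)) fun φ hφ hφc => ?_
  simp only [smul_eq_mul, mul_comm (φ _)]
  rw [hv.2 φ hφ.continuous hφc, hT.integral_pushDensity_mul hξ hξc]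

/-- Each coordinate of `pushGrad` is itself a push-forward, of `pullGradCoord`. The duality ∫ (T_♯u)
ζ = ∫ u (ζ ∘ T) therefore applies on both sides and leaves exactly the weak chain rule. -/
theorem IsPushforward.isWeakGradient_pushGrad {u v : Space d → ℝ} {g : Space d → Space d}
    {t : ℝ} (hv : IsPushforward (T t) u v) (hT : IsFlow ξ T) (hξ : ContDiff ℝ ∞ ξ)
    (hξc : HasCompactSupport ξ) (hu : MemLp u 2) (hgL : MemLp g 2) (hg : IsWeakGradient u g) :
    IsWeakGradient v (pushGrad ξ T t u g) := by
  refine ⟨hv.1, (hT.memLp_pushGrad hξ hξc t hu hgL).locallyIntegrable (by norm_num),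
    fun φ hφ hφc i => ?_⟩
  simp only [pushGrad_apply]
  rw [hv.2 _ ((hφ.continuous_fderiv (by simp)).clm_apply continuous_const)
    (hφc.fderiv_apply ℝ (stdVec i)), hT.integral_pushDensity_mul hξ hξc,
    hg.integral_mul_fderiv_comp_flow hT hξ hξc t hφ hφc i]

theorem IsPushforward.memH1 {u v : Space d → ℝ} {t : ℝ} (hv : IsPushforward (T t) u v)
    (hT : IsFlow ξ T) (hξ : ContDiff ℝ ∞ ξ) (hξc : HasCompactSupport ξ) (hu : MemH1 u) :
    MemH1 v := by
  obtain ⟨hu2, g, hgL, hg⟩ := hu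
  exact ⟨(memLp_congr_ae (hv.ae_eq_pushDensity hT hξ hξc hu2)).2
    (hT.memLp_pushDensity hξ hξc t hu2), _, hT.memLp_pushGrad hξ hξc t hu2 hgL,
    hv.isWeakGradient_pushGrad hT hξ hξc hu2 hgL hg⟩

/-- The Dirichlet energy of the push-forward, in the original variables. -/
theorem IsPushforward.dirichletEnergy_eq {u v : Space d → ℝ} {g : Space d → Space d} {t : ℝ}
    (hv : IsPushforward (T t) u v) (hT : IsFlow ξ T) (hξ : ContDiff ℝ ∞ ξ)
    (hξc : HasCompactSupport ξ) (hu : MemLp u 2) (hgL : MemLp g 2) (hg : IsWeakGradient u g) :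
    dirichletEnergy v = ∫ y, (1 / 2 : ℝ) * (Real.exp (-logJacobian ξ T t y) *
      ∑ i, pullGradCoord ξ T t u g i y ^ 2) := by
  have h := (hv.isWeakGradient_pushGrad hT hξ hξc hu hgL hg).weakGrad_ae_eq
  have h1 : dirichletEnergy v = ∫ x, (1 / 2 : ℝ) * ‖pushGrad ξ T t u g x‖ ^ 2 := by
    refine integral_congr_ae ?_
    filter_upwards [h] with x hx
    rw [hx]
  -- The Jacobian exp ℓ_t meets exp(-2ℓ_t) from the squared gradient, leaving exp(-ℓ_t).
  rw [h1, ← hT.integral_exp_smul_comp hξ hξc t]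
  refine integral_congr_ae (Filter.Eventually.of_forall fun y => ?_)
  simp only [EuclideanSpace.norm_sq_eq, pushGrad_apply, hT.pushDensity_apply hξ hξc, smul_eq_mul,
    Real.norm_eq_abs, sq_abs, mul_pow, ← Finset.mul_sum, Real.exp_neg]
  have := (Real.exp_pos (logJacobian ξ T t y)).ne'
  field_simp

end DirichletVariation

/-! ### Differentiating the energy at time zero. -/

namespace DirichletVariation

/-- Differentiation under the integral sign at a single point, with a Lipschitz bound at that
point only. -/
theorem hasDerivAt_integral_of_dominated_of_norm_sub_le {α : Type*} [MeasurableSpace α]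
    {μ : Measure α} {F : ℝ → α → ℝ} {F' bound : α → ℝ} {x₀ : ℝ} {s : Set ℝ} (hs : s ∈ nhds x₀)
    (hF_meas : ∀ x ∈ s, AEStronglyMeasurable (F x) μ) (hF_int : Integrable (F x₀) μ)
    (hF'_meas : AEStronglyMeasurable F' μ)
    (h_lip : ∀ᵐ a ∂μ, ∀ x ∈ s, ‖F x a - F x₀ a‖ ≤ bound a * ‖x - x₀‖)
    (hb : Integrable bound μ) (h_diff : ∀ᵐ a ∂μ, HasDerivAt (F · a) (F' a) x₀) :
    Integrable F' μ ∧ HasDerivAt (fun x => ∫ a, F x a ∂μ) (∫ a, F' a ∂μ) x₀ := by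
  obtain ⟨h1, h2⟩ := hasFDerivAt_integral_of_dominated_loc_of_lip' (𝕜 := ℝ)
    (F' := fun a => ContinuousLinearMap.toSpanSingletonCLE (𝕜 := ℝ) (F' a)) hs hF_meas hF_int
    ((ContinuousLinearMap.toSpanSingletonCLE (𝕜 := ℝ)).continuous.comp_aestronglyMeasurable
      hF'_meas) h_lip hb (h_diff.mono fun a ha => ha.hasFDerivAt)
  have h3 := h1.apply_continuousLinearMap (1 : ℝ)
  have h4 := h2.hasDerivAt
  rw [ContinuousLinearMap.integral_apply h1] at h4
  simp only [ContinuousLinearMap.toSpanSingletonCLE_apply_apply, one_smul] at h3 h4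
  exact ⟨h3, h4⟩

theorem abs_exp_sub_one_le_mul_exp (x : ℝ) : |Real.exp x - 1| ≤ |x| * Real.exp |x| := by
  have h1 := Real.add_one_le_exp x
  have h2 := Real.add_one_le_exp (-x)
  have h3 : Real.exp (-x) * Real.exp x = 1 := by rw [← Real.exp_add]; simp
  have h4 : Real.exp x - 1 ≤ x * Real.exp x := by nlinarith [Real.exp_pos x]
  have h5 : (1 : ℝ) ≤ Real.exp |x| := Real.one_le_exp (abs_nonneg x)
  rw [abs_le]
  constructor
  · nlinarith [neg_abs_le x, abs_nonneg x]
  · calc Real.exp x - 1 ≤ x * Real.exp x := h4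
      _ ≤ |x| * Real.exp |x| := by
        gcongr
        · exact le_abs_self x
        · exact le_abs_self x

/-- Meant for `e` = exp(-ℓ_t), `p` a transported gradient coordinate, `q` its value at t = 0, `N` =
|∇u| + |u| and `τ` = |t|. The bound follows from e p² - q² = e(p - q)(p + q) + (e - 1)q². -/
theorem abs_mul_sq_sub_sq_le {e p q N τ a b c c' : ℝ} (he : |e - 1| ≤ a * τ) (he' : |e| ≤ b)
    (hpq : |p - q| ≤ c * τ * N) (hp : |p| ≤ c' * N) (hq : |q| ≤ N) :
    |e * p ^ 2 - q ^ 2| ≤ (b * c * (c' + 1) + a) * N ^ 2 * τ := by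
  have e1 : e * p ^ 2 - q ^ 2 = e * ((p - q) * (p + q)) + (e - 1) * q ^ 2 := by ring
  have h1 : |p + q| ≤ (c' + 1) * N := (abs_add_le p q).trans (by linarith)
  have h2 : |q| ^ 2 ≤ N ^ 2 := by gcongr
  have h3 : |p - q| * |p + q| ≤ c * τ * N * ((c' + 1) * N) :=
    mul_le_mul hpq h1 (abs_nonneg _) ((abs_nonneg _).trans hpq)
  have h4 : |e| * (|p - q| * |p + q|) ≤ b * (c * τ * N * ((c' + 1) * N)) :=
    mul_le_mul he' h3 (by positivity) ((abs_nonneg _).trans he')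
  have h5 : |e - 1| * |q| ^ 2 ≤ a * τ * N ^ 2 :=
    mul_le_mul he h2 (by positivity) ((abs_nonneg _).trans he)
  rw [e1]
  refine (abs_add_le _ _).trans ?_
  rw [abs_mul, abs_mul, abs_mul, abs_pow]
  nlinarith

variable {d : ℕ} {ξ : Space d → Space d} {T : ℝ → Space d → Space d}

theorem IsFlow.exists_norm_invDeriv_sub_id_le (hT : IsFlow ξ T) (hξ : ContDiff ℝ ∞ ξ)
    (hξc : HasCompactSupport ξ) :
    ∃ C, 0 ≤ C ∧ ∀ t, |t| ≤ 1 → ∀ y,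
      ‖invDeriv T t y - ContinuousLinearMap.id ℝ _‖ ≤ C * |t| := by
  obtain ⟨K, hK⟩ := exists_lipschitzWith hξ hξc
  have hT0 : T 0 = id := funext hT.1
  refine ⟨K * Real.exp K, by positivity, fun t ht y => ?_⟩
  -- The base point T_t y is frozen, and the mean value inequality is applied in s alone, between 0
  -- and -t.
  have h := Convex.norm_image_sub_le_of_norm_hasDerivWithin_le (s := Set.Icc (-1 : ℝ) 1)
    (f := fun s => fderiv ℝ (T s) (T t y))
    (f' := fun s => fderiv ℝ ξ (T s (T t y)) ∘L fderiv ℝ (T s) (T t y))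
    (C := K * Real.exp K) (x := 0) (y := -t)
    (fun s _ => (hT.hasDerivAt_fderiv hξ hξc s (T t y)).hasDerivWithinAt)
    (fun s hs => by
      refine (ContinuousLinearMap.opNorm_comp_le _ _).trans ?_
      refine mul_le_mul (norm_fderiv_le_of_lipschitz ℝ hK)
        ((hT.norm_fderiv_le hK s _).trans (Real.exp_le_exp.2 ?_)) (norm_nonneg _) K.2
      exact mul_le_of_le_one_right K.2 (abs_le.2 hs))
    (convex_Icc _ _) (by simp) (by
      rw [abs_le] at ht
      exact ⟨by linarith [ht.2], by linarith [ht.1]⟩)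
  rw [hT0, fderiv_id, sub_zero, norm_neg] at h
  exact h

/-- In DT_{-t}(T_t y) time also moves the base point. Viewing it as the inverse of DT_t(y) avoids
this: the derivative of inversion at the identity is A ↦ -A. -/
theorem IsFlow.hasDerivAt_invDeriv_zero (hT : IsFlow ξ T) (hξ : ContDiff ℝ ∞ ξ)
    (hξc : HasCompactSupport ξ) (y : Space d) :
    HasDerivAt (fun t => invDeriv T t y) (- fderiv ℝ ξ y) 0 := by
  have hT0 : T 0 = id := funext hT.1
  have hinv : ∀ t, invDeriv T t y = Ring.inverse (fderiv ℝ (T t) y) := by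
    intro t
    have h1 : fderiv ℝ (T t) y * invDeriv T t y = 1 := by
      have h := hT.fderiv_neg_comp hξ hξc (-t) (T t y)
      rw [neg_neg, hT.neg_apply_self hξ hξc] at h
      exact h
    exact (Ring.inverse_unit
      (⟨fderiv ℝ (T t) y, invDeriv T t y, h1, hT.fderiv_neg_comp hξ hξc t y⟩ :
        (Space d →L[ℝ] Space d)ˣ)).symm
  have hA := hT.hasDerivAt_fderiv hξ hξc 0 y
  rw [hT0, fderiv_id, ContinuousLinearMap.comp_id] at hA
  have h := (hasFDerivAt_ringInverse (𝕜 := ℝ) (1 : (Space d →L[ℝ] Space d)ˣ))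
  have e0 : fderiv ℝ (T 0) y = ((1 : (Space d →L[ℝ] Space d)ˣ) : Space d →L[ℝ] Space d) := by
    rw [hT0, fderiv_id]; rfl
  rw [← e0] at h
  have h' := h.comp_hasDerivAt (0 : ℝ) hA
  simp only [hinv]
  refine h'.congr_deriv ?_
  simp

theorem IsFlow.invDeriv_zero (hT : IsFlow ξ T) (y : Space d) :
    invDeriv T 0 y = ContinuousLinearMap.id ℝ _ := by
  have hT0 : T 0 = id := funext hT.1
  rw [invDeriv, neg_zero, hT0, fderiv_id]

theorem dLogJacobian_zero (y : Space d) : dLogJacobian ξ T 0 y = 0 := by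
  simp [dLogJacobian]

theorem IsFlow.pullGradCoord_zero (hT : IsFlow ξ T) (u : Space d → ℝ) (g : Space d → Space d)
    (i : Fin d) (y : Space d) : pullGradCoord ξ T 0 u g i y = g y i := by
  simp [pullGradCoord, hT.invDeriv_zero, dLogJacobian_zero, inner_stdVec]

theorem IsFlow.hasDerivAt_pullGradCoord_zero (hT : IsFlow ξ T) (hξ : ContDiff ℝ ∞ ξ)
    (hξc : HasCompactSupport ξ) (u : Space d → ℝ) (g : Space d → Space d) (i : Fin d)
    (y : Space d) :
    HasDerivAt (fun t => pullGradCoord ξ T t u g i y)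
      (- inner ℝ (g y) (fderiv ℝ ξ y (stdVec i)) -
        u y * fderiv ℝ (divergence ξ) y (stdVec i)) 0 := by
  have hB : HasDerivAt (fun t => invDeriv T t y (stdVec i)) (- fderiv ℝ ξ y (stdVec i)) 0 := by
    simpa using (hT.hasDerivAt_invDeriv_zero hξ hξc y).clm_apply
      (hasDerivAt_const (0 : ℝ) (stdVec i))
  have hL := (hT.hasDerivAt_dLogJacobian_zero hξ hξc y).clm_apply hB
  refine (((hasDerivAt_const (0 : ℝ) (g y)).inner ℝ hB).sub (hL.const_mul (u y))).congr_deriv ?_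
  simp [hT.invDeriv_zero, dLogJacobian_zero]

theorem IsFlow.exists_abs_pullGradCoord_sub_le (hT : IsFlow ξ T) (hξ : ContDiff ℝ ∞ ξ)
    (hξc : HasCompactSupport ξ) :
    ∃ C, 0 ≤ C ∧ ∀ t, |t| ≤ 1 → ∀ (u : Space d → ℝ) (g : Space d → Space d) i y,
      |pullGradCoord ξ T t u g i y - g y i| ≤ C * |t| * (‖g y‖ + |u y|) := by
  obtain ⟨K, hK⟩ := exists_lipschitzWith hξ hξc
  obtain ⟨C₁, hC₁, h₁⟩ := hT.exists_norm_invDeriv_sub_id_le hξ hξc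
  obtain ⟨C₂, hC₂, h₂⟩ := hT.exists_norm_dLogJacobian_le hξ hξc 1
  refine ⟨C₁ + C₂ * Real.exp K, by positivity, fun t ht u g i y => ?_⟩
  have e : pullGradCoord ξ T t u g i y - g y i =
      inner ℝ (g y) ((invDeriv T t y - ContinuousLinearMap.id ℝ (Space d)) (stdVec i)) -
        u y * dLogJacobian ξ T t y (invDeriv T t y (stdVec i)) := by
    rw [pullGradCoord, _root_.sub_apply, inner_sub_right, ContinuousLinearMap.id_apply,
      inner_stdVec]
    ring
  have hb1 : ‖(invDeriv T t y - ContinuousLinearMap.id ℝ (Space d)) (stdVec i)‖ ≤ C₁ * |t| := by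
    have := (invDeriv T t y - ContinuousLinearMap.id ℝ (Space d)).le_opNorm (stdVec i)
    rw [norm_stdVec, mul_one] at this
    exact this.trans (h₁ t ht y)
  have hb2 : ‖invDeriv T t y (stdVec i)‖ ≤ Real.exp K := by
    have := (invDeriv T t y).le_opNorm (stdVec i)
    rw [norm_stdVec, mul_one] at this
    exact this.trans ((hT.norm_invDeriv_le hK t y).trans
      (Real.exp_le_exp.2 (mul_le_of_le_one_right K.2 ht)))
  have hb3 : |dLogJacobian ξ T t y (invDeriv T t y (stdVec i))| ≤ C₂ * |t| * Real.exp K :=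
    ((dLogJacobian ξ T t y).le_opNorm _).trans
      (mul_le_mul (h₂ t y ht) hb2 (norm_nonneg _) (by positivity))
  have hb4 := (abs_real_inner_le_norm (g y)
    ((invDeriv T t y - ContinuousLinearMap.id ℝ (Space d)) (stdVec i))).trans
    (mul_le_mul_of_nonneg_left hb1 (norm_nonneg (g y)))
  have hb5 := mul_le_mul_of_nonneg_left hb3 (abs_nonneg (u y))
  rw [e]
  refine (abs_sub _ _).trans ?_
  rw [abs_mul]
  have p1 : 0 ≤ ‖g y‖ * (C₂ * |t| * Real.exp K) := by positivity
  have p2 : 0 ≤ |u y| * (C₁ * |t|) := by positivity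
  linarith

theorem sum_mul_map_stdVec (L : Space d →ₗ[ℝ] ℝ) (v : Space d) :
    ∑ i, v i * L (stdVec i) = L v := by
  conv_rhs => rw [← (EuclideanSpace.basisFun (Fin d) ℝ).sum_repr v]
  simp [stdVec]

/-- This is the shape in which the product rule delivers the derivative of ½ exp(-ℓ_t) ∑ᵢ pᵢ² at t =
0. -/
theorem variationIntegrand_eq_sum (u : Space d → ℝ) (ξ : Space d → Space d) (y : Space d) :
    variationIntegrand u ξ y = (1 / 2 : ℝ) * (-divergence ξ y * ∑ i, weakGrad u y i ^ 2 +
      ∑ i, 2 * weakGrad u y i * (- inner ℝ (weakGrad u y) (fderiv ℝ ξ y (stdVec i)) -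
        u y * fderiv ℝ (divergence ξ) y (stdVec i))) := by
  set g := weakGrad u y with hg
  have h1 : inner ℝ g (fderiv ℝ ξ y g) = ∑ i, g i * inner ℝ g (fderiv ℝ ξ y (stdVec i)) :=
    (sum_mul_map_stdVec ((innerSL ℝ g ∘L fderiv ℝ ξ y : Space d →L[ℝ] ℝ) : Space d →ₗ[ℝ] ℝ)
      g).symm
  have h2 : inner ℝ g (gradient (divergence ξ) y) =
      ∑ i, g i * fderiv ℝ (divergence ξ) y (stdVec i) := by
    rw [real_inner_comm, gradient, InnerProductSpace.toDual_symm_apply]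
    exact (sum_mul_map_stdVec (fderiv ℝ (divergence ξ) y : Space d →ₗ[ℝ] ℝ) g).symm
  have h3 : ‖g‖ ^ 2 = ∑ i, g i ^ 2 := by simp [EuclideanSpace.norm_sq_eq]
  rw [variationIntegrand, ← hg, h1, h2, h3]
  have h4 : ∑ i, 2 * g i * (- inner ℝ g (fderiv ℝ ξ y (stdVec i)) -
      u y * fderiv ℝ (divergence ξ) y (stdVec i)) =
      -2 * (∑ i, g i * inner ℝ g (fderiv ℝ ξ y (stdVec i))) -
      2 * u y * ∑ i, g i * fderiv ℝ (divergence ξ) y (stdVec i) := by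
    rw [Finset.mul_sum, Finset.mul_sum, ← Finset.sum_sub_distrib]
    exact Finset.sum_congr rfl fun i _ => by ring
  rw [h4]
  ring

theorem MemH1.isWeakGradient_weakGrad {u : Space d → ℝ} (hu : MemH1 u) :
    IsWeakGradient u (weakGrad u) :=
  let ⟨_, _, _, hg⟩ := hu
  hg.isWeakGradient_weakGrad

theorem MemH1.memLp_weakGrad {u : Space d → ℝ} (hu : MemH1 u) : MemLp (weakGrad u) 2 :=
  let ⟨_, _, hgL, hg⟩ := hu
  (memLp_congr_ae hg.weakGrad_ae_eq).2 hgL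

theorem IsFlow.hasDerivAt_energyDensity_zero (hT : IsFlow ξ T) (hξ : ContDiff ℝ ∞ ξ)
    (hξc : HasCompactSupport ξ) (u : Space d → ℝ) (y : Space d) :
    HasDerivAt (fun t => (1 / 2 : ℝ) * (Real.exp (-logJacobian ξ T t y) *
      ∑ i, pullGradCoord ξ T t u (weakGrad u) i y ^ 2)) (variationIntegrand u ξ y) 0 := by
  have h1 := (hT.hasDerivAt_logJacobian hξ 0 y).neg.exp
  have h2 : HasDerivAt (fun t => ∑ i, pullGradCoord ξ T t u (weakGrad u) i y ^ 2) _ 0 :=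
    HasDerivAt.fun_sum fun i _ =>
      (hT.hasDerivAt_pullGradCoord_zero hξ hξc u (weakGrad u) i y).pow 2
  refine ((h1.mul h2).const_mul (1 / 2 : ℝ)).congr_deriv ?_
  rw [variationIntegrand_eq_sum]
  simp [hT.pullGradCoord_zero, logJacobian_zero, hT.1]

/-- Supplies the dominating function: the constant is uniform in y, and (|∇u| + |u|)² is integrable
for u ∈ H¹. -/
theorem IsFlow.exists_abs_energyDensity_sub_le (hT : IsFlow ξ T) (hξ : ContDiff ℝ ∞ ξ)
    (hξc : HasCompactSupport ξ) :
    ∃ C, ∀ t, |t| ≤ 1 → ∀ (u : Space d → ℝ) (g : Space d → Space d) y,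
      |(1 / 2 : ℝ) * (Real.exp (-logJacobian ξ T t y) * ∑ i, pullGradCoord ξ T t u g i y ^ 2) -
        (1 / 2 : ℝ) * (Real.exp (-logJacobian ξ T 0 y) * ∑ i, pullGradCoord ξ T 0 u g i y ^ 2)| ≤
        C * (‖g y‖ + |u y|) ^ 2 * |t| := by
  obtain ⟨C₁, hC₁, h₁⟩ := exists_abs_logJacobian_le T hξ hξc
  obtain ⟨C₂, hC₂, h₂⟩ := hT.exists_abs_pullGradCoord_sub_le hξ hξc
  obtain ⟨C₃, hC₃, h₃⟩ := hT.exists_abs_pullGradCoord_le hξ hξc 1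
  -- Each of the d coordinates contributes the constant of `abs_mul_sq_sub_sq_le` with a = C₁ exp
  -- C₁, b = exp C₁, c = C₂ and c' = C₃.
  refine ⟨1 / 2 * (d * (Real.exp C₁ * C₂ * (C₃ + 1) + C₁ * Real.exp C₁)),
    fun t ht u g y => ?_⟩
  have hℓ : |-logJacobian ξ T t y| ≤ C₁ := by
    rw [abs_neg]
    exact (h₁ t y).trans (mul_le_of_le_one_right hC₁ ht)
  have he : |Real.exp (-logJacobian ξ T t y) - 1| ≤ C₁ * Real.exp C₁ * |t| := by
    refine (abs_exp_sub_one_le_mul_exp _).trans ?_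
    have := mul_le_mul ((abs_neg (logJacobian ξ T t y)).trans_le (h₁ t y))
      (Real.exp_le_exp.2 hℓ) (Real.exp_pos _).le (by positivity)
    linarith
  have he' : |Real.exp (-logJacobian ξ T t y)| ≤ Real.exp C₁ := by
    rw [abs_of_pos (Real.exp_pos _)]
    exact Real.exp_le_exp.2 ((le_abs_self _).trans hℓ)
  simp only [hT.pullGradCoord_zero, logJacobian_zero, neg_zero, Real.exp_zero, one_mul]
  rw [← mul_sub, Finset.mul_sum, ← Finset.sum_sub_distrib, abs_mul, abs_of_pos (by norm_num :
    (0 : ℝ) < 1 / 2)]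
  have hi : ∀ i ∈ Finset.univ, |Real.exp (-logJacobian ξ T t y) *
      pullGradCoord ξ T t u g i y ^ 2 - g y i ^ 2| ≤
      (Real.exp C₁ * C₂ * (C₃ + 1) + C₁ * Real.exp C₁) * (‖g y‖ + |u y|) ^ 2 * |t| := by
    intro i _
    refine abs_mul_sq_sub_sq_le he he' (h₂ t ht u g i y) (h₃ t ht u g i y) ?_
    have := PiLp.norm_apply_le (g y) i
    rw [Real.norm_eq_abs] at this
    linarith [abs_nonneg (u y)]
  have hsum := (Finset.abs_sum_le_sum_abs _ _).trans (Finset.sum_le_sum hi)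
  rw [Finset.sum_const, Finset.card_univ, Fintype.card_fin, nsmul_eq_mul] at hsum
  refine (mul_le_mul_of_nonneg_left hsum (by norm_num : (0 : ℝ) ≤ 1 / 2)).trans_eq ?_
  ring

theorem aestronglyMeasurable_variationIntegrand {u : Space d → ℝ} (hξ : ContDiff ℝ ∞ ξ)
    (hu : AEStronglyMeasurable u) (hg : AEStronglyMeasurable (weakGrad u)) :
    AEStronglyMeasurable (variationIntegrand u ξ) := by
  have hgi : ∀ i, AEStronglyMeasurable fun y => weakGrad u y i := fun i =>
    (EuclideanSpace.proj (𝕜 := ℝ) i).continuous.comp_aestronglyMeasurable hg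
  have h1 : ∀ i, AEStronglyMeasurable fun y =>
      inner ℝ (weakGrad u y) (fderiv ℝ ξ y (stdVec i)) := fun i =>
    hg.inner ((hξ.continuous_fderiv (by simp)).clm_apply continuous_const).aestronglyMeasurable
  have h2 : ∀ i, AEStronglyMeasurable fun y => u y * fderiv ℝ (divergence ξ) y (stdVec i) :=
    fun i => hu.mul
      ((continuous_fderiv_divergence hξ).clm_apply continuous_const).aestronglyMeasurable
  have h3 : AEStronglyMeasurable fun y => divergence ξ y :=
    (contDiff_divergence hξ).continuous.aestronglyMeasurable
  have h4 : AEStronglyMeasurable fun y => ∑ i, weakGrad u y i ^ 2 :=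
    Finset.aestronglyMeasurable_fun_sum _ fun i _ => (hgi i).pow 2
  have h5 : AEStronglyMeasurable fun y => ∑ i, 2 * weakGrad u y i *
      (- inner ℝ (weakGrad u y) (fderiv ℝ ξ y (stdVec i)) -
        u y * fderiv ℝ (divergence ξ) y (stdVec i)) :=
    Finset.aestronglyMeasurable_fun_sum _ fun i _ =>
      ((hgi i).const_mul 2).mul ((h1 i).neg.sub (h2 i))
  have e : variationIntegrand u ξ = _ := funext fun y => variationIntegrand_eq_sum u ξ y
  rw [e]
  exact ((h3.neg.mul h4).add h5).const_mul _

end DirichletVariation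

theorem mainTheorem4 (d : ℕ)
    (u₀ : DirichletVariation.Space d → ℝ) (hu₀ : DirichletVariation.MemH1 u₀)
    (ξ : DirichletVariation.Space d → DirichletVariation.Space d)
    (hξ : ContDiff ℝ ∞ ξ) (hξc : HasCompactSupport ξ)
    (T : ℝ → DirichletVariation.Space d → DirichletVariation.Space d)
    (hT : DirichletVariation.IsFlow ξ T)
    (u : ℝ → DirichletVariation.Space d → ℝ)
    (hu : ∀ t, DirichletVariation.IsPushforward (T t) u₀ (u t)) :
    (∀ t, DirichletVariation.MemH1 (u t)) ∧
    Integrable (DirichletVariation.variationIntegrand u₀ ξ) ∧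
    HasDerivAt (fun t => DirichletVariation.dirichletEnergy (u t))
      (∫ x, DirichletVariation.variationIntegrand u₀ ξ x) 0 := by
  refine ⟨fun t => (hu t).memH1 hT hξ hξc hu₀, ?_⟩
  have hg := hu₀.isWeakGradient_weakGrad
  have hgL := hu₀.memLp_weakGrad
  -- After this the family of energies is an explicit parameter integral; the arbitrary
  -- representatives `u t` and their chosen weak gradients no longer occur in it.
  simp only [(hu _).dirichletEnergy_eq hT hξ hξc hu₀.1 hgL hg]
  obtain ⟨C, hC⟩ := hT.exists_abs_energyDensity_sub_le hξ hξc
  have hp := fun t i => hT.memLp_pullGradCoord hξ hξc t hu₀.1 hgL i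
  have hN : Integrable fun y => C * (‖DirichletVariation.weakGrad u₀ y‖ + |u₀ y|) ^ 2 :=
    (hgL.norm.add hu₀.1.norm).integrable_sq.const_mul C
  -- Integrability of the variation integrand comes from the same domination: it is the pointwise
  -- limit of difference quotients bounded by the dominating function.
  refine DirichletVariation.hasDerivAt_integral_of_dominated_of_norm_sub_le
    (s := Metric.closedBall 0 1) (Metric.closedBall_mem_nhds 0 one_pos) (fun t _ => ?_) ?_
    (DirichletVariation.aestronglyMeasurable_variationIntegrand hξ hu₀.1.1 hgL.1)
    (Filter.Eventually.of_forall fun y t ht => ?_) hN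
    (Filter.Eventually.of_forall fun y => hT.hasDerivAt_energyDensity_zero hξ hξc u₀ y)
  · exact ((Real.continuous_exp.comp
      (hT.contDiff_logJacobian hξ hξc t).continuous.neg).aestronglyMeasurable.mul
      (Finset.aestronglyMeasurable_fun_sum _ fun i _ => (hp t i).1.pow 2)).const_mul _
  · simp only [DirichletVariation.logJacobian_zero, neg_zero, Real.exp_zero, one_mul]
    exact (integrable_finsetSum _ fun i _ => (hp 0 i).integrable_sq).const_mul _
  · rw [mem_closedBall_zero_iff] at ht
    simpa using hC t ht u₀ (DirichletVariation.weakGrad u₀) y
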